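/- Let $(\overline M,\bar g)$ be a hyper-Kähler manifold: a smooth Riemannian manifold of dimension $4m$ with smooth $\bar g$-orthogonal almost complex structures $J_1,J_2,J_3$ that anticommute pairwise, satisfy $J_1J_2=\varepsilon J_3$ for a fixed sign $\varepsilon\in\{1,-1\}$, and are parallel for the Levi-Civita connection. Let $M$ be an oriented smooth $7$-manifold and $f:M\to\overline M$ a smooth immersion which makes $M$ a QR-submanifold of hypersurface type: the normal bundle is an orthogonal direct sum $\nu\oplus\nu^\perp$ of smooth subbundles with $J_i\nu\subset\nu$ and $J_i\nu^\perp\subset TM$ for $i=1,2,3$, and $\nu^\perp$ has rank $1$. Let $g$ be the induced metric on $M$, and identify $T_pM$ with its image in $T_{f(p)}\overline M$. Then $M$ carries a $G_2$-structure, constructed as follows. There are a smooth global unit section $n$ of $\nu^\perp$, smooth vector fields $\xi_i=J_in$ on $M$ ($i=1,2,3$), a smooth alternating bilinear map $P:TM\times TM\to TM$, and a smooth $3$-form $\Omega$ on $M$ such that: (a) $P$ is a cross product compatible with $g$: $g(P(x,y),x)=g(P(x,y),y)=0$, $\|P(x,y)\|^2=\|x\|^2\|y\|^2-g(x,y)^2$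 and $P(x,P(x,y))=-\|x\|^2y+g(x,y)x$ for all $x,y\in T_pM$; (b) $P(\xi_i,\xi_j)=-\varepsilon\,\xi_k$ for every cyclic permutation $(i,j,k)$ of $(1,2,3)$ (so $P(\xi_i,\xi_j)=\xi_k$ in the convention $J_1J_2=-J_3$), and for every $x\in T_pM$ orthogonal to $\xi_1,\xi_2,\xi_3$ one has $P(\xi_i,x)=J_ix$ and $P(x,J_ix)=\|x\|^2\xi_i$; (c) $\Omega(x,y,z)=g(P(x,y),z)$, and at every point $p$ there is a positively oriented $g$-orthonormal basis of $T_pM$ whose dual basis $x^1,\dots,x^7$ satisfies $$\Omega_p=x^{127}+x^{136}+x^{145}+x^{235}-x^{246}+x^{347}+x^{567},\qquad x^{ijk}=x^i\wedge x^j\wedge x^k .$$ In particular $\Omega$ is a $G_2$-structure on $M$ that induces the given orientation and the metric $g$. -/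

import Mathlib

open Bundle Set Module
open scoped Manifold ContDiff

noncomputable section

namespace QRG2

/-! ### Hyper-Kähler manifolds -/

section HyperKahler

variable {E : Type*} [NormedAddCommGroup E] [NormedSpace ℝ E] [FiniteDimensional ℝ E]
  (N : Type*) [TopologicalSpace N] [ChartedSpace E N]
  [IsManifold 𝓘(ℝ, E) ∞ N]
  [RiemannianBundle (fun x : N ↦ TangentSpace 𝓘(ℝ, E) x)]
  [IsContMDiffRiemannianBundle 𝓘(ℝ, E) ∞ E (fun x : N ↦ TangentSpace 𝓘(ℝ, E) x)]

variable {N} in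
/-- A vector field on `N` is differentiable at `x`. -/
def DiffFieldAt (X : (x : N) → TangentSpace 𝓘(ℝ, E) x) (x : N) : Prop :=
  MDifferentiableAt 𝓘(ℝ, E) 𝓘(ℝ, E).tangent (fun y ↦ (⟨y, X y⟩ : TangentBundle 𝓘(ℝ, E) N)) x

/-- A connection on the tangent bundle is the Levi-Civita connection of the Riemannian metric when
`d⟨Y, Z⟩ = ⟨∇Y, Z⟩ + ⟨Y, ∇Z⟩` for all differentiable vector fields and it has no torsion. -/
def IsLeviCivita
    (D : CovariantDerivative 𝓘(ℝ, E) E (fun x : N ↦ TangentSpace 𝓘(ℝ, E) x)) : Prop :=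
  (∀ (Y Z : (x : N) → TangentSpace 𝓘(ℝ, E) x) (x : N), DiffFieldAt Y x → DiffFieldAt Z x →
    ∀ v : TangentSpace 𝓘(ℝ, E) x,
      (mfderiv 𝓘(ℝ, E) 𝓘(ℝ, ℝ) (fun y ↦ (inner ℝ (Y y) (Z y) : ℝ)) x v : ℝ) =
        inner ℝ (D Y x v) (Z x) + inner ℝ (Y x) (D Z x v)) ∧
  D.torsion = 0

/-- A hyper-Kähler structure on a smooth Riemannian manifold: three smooth
orthogonal almost complex structures `J 0`, `J 1`, `J 2` (the usual `J_1`, `J_2`, `J_3`) that satisfy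
the quaternionic relations and are parallel for the Levi-Civita connection. Both conventions
`J_1 J_2 = J_3` (`ε = 1`) and `J_1 J_2 = - J_3` (`ε = -1`) are allowed. -/
structure HyperKahlerStructure where
  /-- the dimension of the manifold is a multiple of `4` -/
  dim : ∃ m : ℕ, finrank ℝ E = 4 * m
  /-- the three complex structures -/
  J : Fin 3 → (x : N) → TangentSpace 𝓘(ℝ, E) x →L[ℝ] TangentSpace 𝓘(ℝ, E) x
  /-- the sign in `J_1 J_2 = ε J_3` -/
  ε : ℝ
  ε_eq : ε = 1 ∨ ε = -1
  smooth : ∀ i, ContMDiff 𝓘(ℝ, E) (𝓘(ℝ, E).prod 𝓘(ℝ, E →L[ℝ] E)) ∞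
    (fun x ↦ TotalSpace.mk' (E →L[ℝ] E)
      (E := fun x : N ↦ TangentSpace 𝓘(ℝ, E) x →L[ℝ] TangentSpace 𝓘(ℝ, E) x) x (J i x))
  orthogonal : ∀ i x (v w : TangentSpace 𝓘(ℝ, E) x),
    inner ℝ (J i x v) (J i x w) = inner ℝ v w
  sq : ∀ i x v, J i x (J i x v) = -v
  anticomm : ∀ i j x v, i ≠ j → J i x (J j x v) = -J j x (J i x v)
  mul : ∀ x v, J 0 x (J 1 x v) = ε • J 2 x v
  parallel : ∃ D : CovariantDerivative 𝓘(ℝ, E) E (fun x : N ↦ TangentSpace 𝓘(ℝ, E) x),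
    IsLeviCivita N D ∧
    ∀ (i : Fin 3) (X : (x : N) → TangentSpace 𝓘(ℝ, E) x) (x : N),
      DiffFieldAt X x → ∀ v : TangentSpace 𝓘(ℝ, E) x, D (fun y ↦ J i y (X y)) x v = J i x (D X x v)

end HyperKahler

/-! ### Oriented 7-manifolds, smooth tensor fields, G₂-structures -/

section SevenManifolds

variable (M : Type*) [TopologicalSpace M] [ChartedSpace (EuclideanSpace ℝ (Fin 7)) M]
  [IsManifold (𝓡 7) ∞ M]

variable {M} in
/-- A vector field on a 7-manifold is smooth on `U`. -/
def SmoothFieldOn (U : Set M) (X : (p : M) → TangentSpace (𝓡 7) p) : Prop :=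
  ContMDiffOn (𝓡 7) (𝓡 7).tangent ∞ (fun p ↦ (⟨p, X p⟩ : TangentBundle (𝓡 7) M)) U

/-- An orientation of a 7-manifold: orientations of the tangent spaces, such that near each point
there is a smooth positively oriented frame. -/
structure ManifoldOrientation where
  /-- the orientation of each tangent space -/
  at_point : (p : M) → Orientation ℝ (TangentSpace (𝓡 7) p) (Fin 7)
  locally_const : ∀ p : M, ∃ U : Set M, IsOpen U ∧ p ∈ U ∧
    ∃ b : (q : M) → Basis (Fin 7) ℝ (TangentSpace (𝓡 7) q),
      (∀ i, SmoothFieldOn U (fun q ↦ b q i)) ∧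
      ∀ q ∈ U, (b q).orientation = at_point q

variable {M}

/-- The `3`-form `x^i ∧ x^j ∧ x^k` on `ℝ⁷`. -/
def coordWedge (i j k : Fin 7) : (Fin 7 → ℝ) [⋀^Fin 3]→ₗ[ℝ] ℝ :=
  (Matrix.detRowAlternating (n := Fin 3) (R := ℝ)).compLinearMap
    (LinearMap.funLeft ℝ ℝ ![i, j, k])

/-- The standard `G₂`-form
`x^{127} + x^{136} + x^{145} + x^{235} - x^{246} + x^{347} + x^{567}` on `ℝ⁷`
(coordinates are numbered from `0` below). -/
def omegaZero : (Fin 7 → ℝ) [⋀^Fin 3]→ₗ[ℝ] ℝ :=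
  coordWedge 0 1 6 + coordWedge 0 2 5 + coordWedge 0 3 4 + coordWedge 1 2 4
    - coordWedge 1 3 5 + coordWedge 2 3 6 + coordWedge 4 5 6

/-- A basis of the tangent space at `p` is adapted to a `3`-form if the form has the standard
`G₂` expression in the dual basis. -/
def IsAdapted {p : M} (φ : (TangentSpace (𝓡 7) p) [⋀^Fin 3]→ₗ[ℝ] ℝ)
    (b : Basis (Fin 7) ℝ (TangentSpace (𝓡 7) p)) : Prop :=
  φ = omegaZero.compLinearMap (b.equivFun : TangentSpace (𝓡 7) p →ₗ[ℝ] (Fin 7 → ℝ))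

/-- A `G₂`-structure on an oriented 7-manifold: a smooth global `3`-form that at each point is
identified with the standard form by an orientation preserving linear isomorphism with `ℝ⁷`. -/
structure G2Structure (o : ManifoldOrientation M) where
  /-- the `3`-form -/
  form : (p : M) → (TangentSpace (𝓡 7) p) [⋀^Fin 3]→ₗ[ℝ] ℝ
  smooth : ∀ (U : Set M) (X : Fin 3 → (p : M) → TangentSpace (𝓡 7) p), IsOpen U →
    (∀ i, SmoothFieldOn U (X i)) →
    ContMDiffOn (𝓡 7) 𝓘(ℝ, ℝ) ∞ (fun p ↦ form p (fun i ↦ X i p)) U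
  standard : ∀ p, ∃ b : Basis (Fin 7) ℝ (TangentSpace (𝓡 7) p),
    b.orientation = o.at_point p ∧ IsAdapted (form p) b

/-- A field of bilinear maps `TM × TM → TM` is smooth: it sends smooth local vector fields to
smooth local vector fields. -/
def SmoothBilinear
    (P : (p : M) → TangentSpace (𝓡 7) p →ₗ[ℝ] TangentSpace (𝓡 7) p →ₗ[ℝ] TangentSpace (𝓡 7) p) :
    Prop :=
  ∀ (U : Set M) (X Y : (p : M) → TangentSpace (𝓡 7) p), IsOpen U →
    SmoothFieldOn U X → SmoothFieldOn U Y → SmoothFieldOn U (fun p ↦ P p (X p) (Y p))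

/-- `P` is a cross product compatible with the metric `g` (a field of bilinear forms on `TM`). -/
structure IsCrossProduct (g : (p : M) → TangentSpace (𝓡 7) p → TangentSpace (𝓡 7) p → ℝ)
    (P : (p : M) → TangentSpace (𝓡 7) p →ₗ[ℝ] TangentSpace (𝓡 7) p →ₗ[ℝ] TangentSpace (𝓡 7) p) :
    Prop where
  smooth : SmoothBilinear P
  alternating : ∀ p x, P p x x = 0
  orthogonal_left : ∀ p x y, g p (P p x y) x = 0
  orthogonal_right : ∀ p x y, g p (P p x y) y = 0
  norm_sq : ∀ p x y, g p (P p x y) (P p x y) = g p x x * g p y y - g p x y ^ 2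
  double : ∀ p x y, P p x (P p x y) = -g p x x • y + g p x y • x

end SevenManifolds

/-! ### QR-submanifolds -/

section QR

variable {E : Type*} [NormedAddCommGroup E] [NormedSpace ℝ E] [FiniteDimensional ℝ E]
    {N : Type*} [TopologicalSpace N]
  [ChartedSpace E N] [IsManifold 𝓘(ℝ, E) ∞ N]
  [RiemannianBundle (fun x : N ↦ TangentSpace 𝓘(ℝ, E) x)]
  [IsContMDiffRiemannianBundle 𝓘(ℝ, E) ∞ E (fun x : N ↦ TangentSpace 𝓘(ℝ, E) x)]
  {M : Type*} [TopologicalSpace M] [ChartedSpace (EuclideanSpace ℝ (Fin 7)) M]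
  [IsManifold (𝓡 7) ∞ M]

variable (E) in
/-- The metric induced on `M` by a map `f : M → N`. -/
def inducedMetric (f : M → N) (p : M) (x y : TangentSpace (𝓡 7) p) : ℝ :=
  inner ℝ (mfderiv (𝓡 7) 𝓘(ℝ, E) f p x) (mfderiv (𝓡 7) 𝓘(ℝ, E) f p y)

/-- The tangent space of the submanifold, inside the tangent space of `N`. -/
def tangentImage (f : M → N) (p : M) : Submodule ℝ (TangentSpace 𝓘(ℝ, E) (f p)) :=
  LinearMap.range
    (mfderiv (𝓡 7) 𝓘(ℝ, E) f p : TangentSpace (𝓡 7) p →ₗ[ℝ] TangentSpace 𝓘(ℝ, E) (f p))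

/-- The normal space of the submanifold. -/
def normalSpace (f : M → N) (p : M) : Submodule ℝ (TangentSpace 𝓘(ℝ, E) (f p)) :=
  (tangentImage f p)ᗮ

/-- The orthogonal complement `ν^⊥` of `ν` in the normal space. -/
def nuPerp (f : M → N) (ν : (p : M) → Submodule ℝ (TangentSpace 𝓘(ℝ, E) (f p))) (p : M) :
    Submodule ℝ (TangentSpace 𝓘(ℝ, E) (f p)) :=
  (ν p)ᗮ ⊓ normalSpace f p

/-- A vector field along `f` is smooth on `U`. -/
def SmoothAlongOn (f : M → N) (U : Set M) (s : (p : M) → TangentSpace 𝓘(ℝ, E) (f p)) : Prop :=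
  ContMDiffOn (𝓡 7) 𝓘(ℝ, E).tangent ∞
    (fun p ↦ (⟨f p, s p⟩ : TangentBundle 𝓘(ℝ, E) N)) U

/-- A family of subspaces of the pulled back tangent bundle `f^* TN` is a smooth subbundle: it has
smooth frames locally. -/
def IsSmoothSubbundleAlong (f : M → N)
    (W : (p : M) → Submodule ℝ (TangentSpace 𝓘(ℝ, E) (f p))) : Prop :=
  ∀ p : M, ∃ U : Set M, IsOpen U ∧ p ∈ U ∧
    ∃ (k : ℕ) (s : Fin k → (q : M) → TangentSpace 𝓘(ℝ, E) (f q)),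
      (∀ i, SmoothAlongOn f U (s i)) ∧
      ∀ q ∈ U, LinearIndependent ℝ (fun i ↦ s i q) ∧
        Submodule.span ℝ (Set.range fun i ↦ s i q) = W q

/-- `M`, immersed in the hyper-Kähler manifold `N` by `f`, is a QR-submanifold with respect to the
subbundle `ν` of the normal bundle. -/
structure IsQRSubmanifold (h : HyperKahlerStructure (E := E) N) (f : M → N)
    (ν : (p : M) → Submodule ℝ (TangentSpace 𝓘(ℝ, E) (f p))) : Prop where
  smooth : ContMDiff (𝓡 7) 𝓘(ℝ, E) ∞ f
  immersive : ∀ p, Function.Injective (mfderiv (𝓡 7) 𝓘(ℝ, E) f p)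
  normal : ∀ p, ν p ≤ normalSpace f p
  smooth_nu : IsSmoothSubbundleAlong f ν
  smooth_nuPerp : IsSmoothSubbundleAlong f (nuPerp f ν)
  J_nu : ∀ i p, ∀ v ∈ ν p, h.J i (f p) v ∈ ν p
  J_nuPerp : ∀ i p, ∀ v ∈ nuPerp f ν p, h.J i (f p) v ∈ tangentImage f p

/-- A QR-submanifold of hypersurface type: `ν^⊥` has rank one. -/
structure IsHypersurfaceTypeQR (h : HyperKahlerStructure (E := E) N) (f : M → N)
    (ν : (p : M) → Submodule ℝ (TangentSpace 𝓘(ℝ, E) (f p))) : Prop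
    extends IsQRSubmanifold h f ν where
  rank_one : ∀ p, finrank ℝ (nuPerp f ν p) = 1

end QR

end QRG2

end

/-! At a point of M, choose a unit vector n in `ν^⊥`. The vectors ξ_i = J_i n span a 3-dimensional
vertical subspace of the tangent space. Its 4-dimensional orthogonal complement there is invariant
under all J_i: if x is horizontal, J_i x is orthogonal to ν because J_i preserves ν, and to n
because x is orthogonal to J_i n (`IsHypersurfaceTypeQR.isUnitNormal`). So the tangent space looks
like Im ℍ ⊕ ℍ, and the usual formula for the cross product of imaginary octonions makes sense on it
(`crossAux`).

Any unit horizontal x completes, with its images J_i x and the ξ_i, to an orthonormal 7-frame in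
which this product has the standard structure constants (`cross_sum_adaptedFrame`). The axioms of a
cross product and the normal form of Ω are thereby reduced to polynomial identities on ℝ⁷.

What remains is global: the sign of n. Passing from n to -n reverses the three vertical frame
vectors and moves the horizontal ones by a quaternionic matrix of nonnegative determinant, so
adapted frames of n and of -n have opposite orientations (`IsFrameBasis.orientation_ne`). The
orientation of M therefore selects exactly one of the two normals at each point. Compatibility with
the orientation is an open condition on a smooth local unit section
(`eventually_exists_frameBasis`), so the selected normal agrees locally with a smooth section
(`exists_unit_normal`). Smoothness of P and of the ξ_i is first visible along f; it descends to M by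
Cramer's rule (`SmoothFieldAt.of_differential`). -/

noncomputable section

set_option linter.unusedSectionVars false

namespace QRG2

/-! ### Linear algebra of a quaternionic Hermitian space -/

section LinearAlgebra

variable {W : Type*} [NormedAddCommGroup W] [InnerProductSpace ℝ W]

/-- Three orthogonal complex structures on a Euclidean space with the quaternionic relations. -/
structure IsQuaternionicTriple (J : Fin 3 → W →ₗ[ℝ] W) (ε : ℝ) : Prop where
  sign : ε = 1 ∨ ε = -1
  inner_map : ∀ i v w, inner ℝ (J i v) (J i w) = inner ℝ v w
  sq : ∀ i v, J i (J i v) = -v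
  anticomm : ∀ i j v, i ≠ j → J i (J j v) = -J j (J i v)
  mul : ∀ v, J 0 (J 1 v) = ε • J 2 v

namespace IsQuaternionicTriple

variable {J : Fin 3 → W →ₗ[ℝ] W} {ε : ℝ} (hJ : IsQuaternionicTriple J ε)

include hJ

lemma sign_mul_self : ε * ε = 1 := by
  rcases hJ.sign with h | h <;> simp [h]

lemma inner_left (i v w) : inner ℝ (J i v) w = -inner ℝ v (J i w) := by
  rw [← hJ.inner_map i v (J i w), hJ.sq, inner_neg_right, neg_neg]

lemma norm_map (i v) : ‖J i v‖ = ‖v‖ := by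
  rw [← sq_eq_sq₀ (norm_nonneg _) (norm_nonneg _), ← real_inner_self_eq_norm_sq,
    ← real_inner_self_eq_norm_sq, hJ.inner_map]

lemma norm_sign : |ε| = 1 := by
  rcases hJ.sign with h | h <;> simp [h]

lemma inner_self (i v) : inner ℝ (J i v) v = 0 := by
  have h := hJ.inner_left i v v
  rw [real_inner_comm] at h
  rw [real_inner_comm]
  linarith

lemma inner_self' (i v) : inner ℝ v (J i v) = 0 := by
  rw [real_inner_comm, hJ.inner_self]

/-- This and the next four lemmas complete the multiplication table from the single relation `mul`,
using ε² = 1 and anticommutation. -/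
lemma mul10 (v) : J 1 (J 0 v) = -(ε • J 2 v) := by
  rw [hJ.anticomm 1 0 v (by decide), hJ.mul]

lemma mul02 (v) : J 0 (J 2 v) = -(ε • J 1 v) := by
  have h : J 2 v = ε • J 0 (J 1 v) := by rw [hJ.mul, smul_smul, hJ.sign_mul_self, one_smul]
  rw [h, map_smul, hJ.sq, smul_neg]

lemma mul20 (v) : J 2 (J 0 v) = ε • J 1 v := by
  rw [hJ.anticomm 2 0 v (by decide), hJ.mul02, neg_neg]

lemma mul21 (v) : J 2 (J 1 v) = -(ε • J 0 v) := by
  have h : J 2 (J 1 v) = ε • J 0 (J 1 (J 1 v)) := by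
    rw [hJ.mul, smul_smul, hJ.sign_mul_self, one_smul]
  rw [h, hJ.sq, map_neg, smul_neg]

lemma mul12 (v) : J 1 (J 2 v) = ε • J 0 v := by
  rw [hJ.anticomm 1 2 v (by decide), hJ.mul21, neg_neg]

lemma inner_ne {i j : Fin 3} (hij : i ≠ j) (v) : inner ℝ (J i v) (J j v) = 0 := by
  rw [hJ.inner_left]
  have key : ∀ k : Fin 3, inner ℝ v (J k v) = 0 := fun k ↦ hJ.inner_self' k v
  fin_cases i <;> fin_cases j <;>
    simp_all [hJ.mul, hJ.mul10, hJ.mul02, hJ.mul20, hJ.mul12, hJ.mul21, inner_smul_right]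

end IsQuaternionicTriple

/-! ### The cross product attached to a unit vector -/

/-- The component of `u` orthogonal to `J i n`. -/
def horizontalPart (J : Fin 3 → W →ₗ[ℝ] W) (n u : W) : W :=
  u - ∑ i, (inner ℝ u (J i n) : ℝ) • J i n

/-- The cross product determined by a unit vector `n`. -/
def crossAux (J : Fin 3 → W →ₗ[ℝ] W) (ε : ℝ) (n u v : W) : W :=
  ∑ i, ((-ε * (inner ℝ u (J (i + 1) n) * inner ℝ v (J (i + 2) n)
      - inner ℝ u (J (i + 2) n) * inner ℝ v (J (i + 1) n))
      + inner ℝ (J i (horizontalPart J n u)) (horizontalPart J n v) : ℝ) • J i n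
    + ((inner ℝ u (J i n) : ℝ) • J i (horizontalPart J n v)
      - (inner ℝ v (J i n) : ℝ) • J i (horizontalPart J n u)))

lemma horizontalPart_add (J : Fin 3 → W →ₗ[ℝ] W) (n u v : W) :
    horizontalPart J n (u + v) = horizontalPart J n u + horizontalPart J n v := by
  simp only [horizontalPart, inner_add_left, Fin.sum_univ_three]
  module

lemma horizontalPart_smul (J : Fin 3 → W →ₗ[ℝ] W) (n : W) (c : ℝ) (u : W) :
    horizontalPart J n (c • u) = c • horizontalPart J n u := by
  simp only [horizontalPart, real_inner_smul_left, Fin.sum_univ_three]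
  module

/-- `crossAux` as a bilinear map. -/
def cross (J : Fin 3 → W →ₗ[ℝ] W) (ε : ℝ) (n : W) : W →ₗ[ℝ] W →ₗ[ℝ] W :=
  LinearMap.mk₂ ℝ (crossAux J ε n)
    (fun u u' v ↦ by
      simp only [crossAux, horizontalPart_add, inner_add_left, map_add, Fin.sum_univ_three]
      module)
    (fun c u v ↦ by
      simp only [crossAux, horizontalPart_smul, real_inner_smul_left, map_smul,
        Fin.sum_univ_three]
      module)
    (fun u v v' ↦ by
      simp only [crossAux, horizontalPart_add, inner_add_left, inner_add_right, map_add,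
        Fin.sum_univ_three]
      module)
    (fun c u v ↦ by
      simp only [crossAux, horizontalPart_smul, real_inner_smul_left, real_inner_smul_right,
        map_smul, Fin.sum_univ_three]
      module)

lemma cross_apply (J : Fin 3 → W →ₗ[ℝ] W) (ε : ℝ) (n u v : W) :
    cross J ε n u v = crossAux J ε n u v := rfl

lemma horizontalPart_of_orthogonal (J : Fin 3 → W →ₗ[ℝ] W) {n u : W}
    (hu : ∀ i, inner ℝ (J i n) u = 0) : horizontalPart J n u = u := by
  simp [horizontalPart, fun i ↦ (real_inner_comm _ _).trans (hu i)]

namespace IsQuaternionicTriple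

variable {J : Fin 3 → W →ₗ[ℝ] W} {ε : ℝ} (hJ : IsQuaternionicTriple J ε)

include hJ

lemma inner_eq_ite {n : W} (hn : ‖n‖ = 1) (i j : Fin 3) :
    inner ℝ (J i n) (J j n) = if i = j then 1 else 0 := by
  split_ifs with h
  · rw [h, hJ.inner_map, real_inner_self_eq_norm_sq, hn, one_pow]
  · exact hJ.inner_ne h n

lemma horizontalPart_vertical {n : W} (hn : ‖n‖ = 1) (i : Fin 3) :
    horizontalPart J n (J i n) = 0 := by
  simp [horizontalPart, hJ.inner_eq_ite hn]

lemma inner_horizontalPart {n : W} (hn : ‖n‖ = 1) (i : Fin 3) (u : W) :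
    inner ℝ (J i n) (horizontalPart J n u) = 0 := by
  simp [horizontalPart, inner_sub_right, inner_sum, real_inner_smul_right, hJ.inner_eq_ite hn,
    real_inner_comm]

lemma cross_vertical {n : W} (hn : ‖n‖ = 1) (i : Fin 3) :
    cross J ε n (J i n) (J (i + 1) n) = -ε • J (i + 2) n := by
  simp only [cross_apply, crossAux, hJ.horizontalPart_vertical hn, hJ.inner_eq_ite hn]
  fin_cases i <;> simp [Fin.sum_univ_three]

lemma cross_vertical_horizontal {n u : W} (hn : ‖n‖ = 1) (hu : ∀ i, inner ℝ (J i n) u = 0)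
    (i : Fin 3) : cross J ε n (J i n) u = J i u := by
  have hu' : ∀ i, inner ℝ u (J i n) = 0 := fun i ↦ by rw [real_inner_comm, hu]
  simp [cross_apply, crossAux, hJ.horizontalPart_vertical hn, hJ.inner_eq_ite hn,
    horizontalPart_of_orthogonal J hu, hu']

/-- Moving `J j` to the other side gives `J j (J i n)`, which is up to sign n or some `J k n`, and u
is orthogonal to all of these. -/
lemma inner_vertical_map {n u : W} (hu : ∀ i, inner ℝ (J i n) u = 0)
    (hnu : inner ℝ n u = 0) (i j : Fin 3) : inner ℝ (J i n) (J j u) = 0 := by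
  rw [← neg_eq_zero, ← hJ.inner_left]
  fin_cases i <;> fin_cases j <;>
    simp_all [hJ.sq, hJ.mul, hJ.mul10, hJ.mul02, hJ.mul20, hJ.mul12, hJ.mul21,
      real_inner_smul_left]

lemma cross_horizontal_map {n u : W} (hu : ∀ i, inner ℝ (J i n) u = 0)
    (hnu : inner ℝ n u = 0) (i : Fin 3) :
    cross J ε n u (J i u) = (inner ℝ u u : ℝ) • J i n := by
  have hu' : ∀ i, inner ℝ u (J i n) = 0 := fun i ↦ by rw [real_inner_comm, hu]
  have hv := fun j ↦ hJ.inner_vertical_map hu hnu j i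
  have hv' : ∀ j, inner ℝ (J i u) (J j n) = 0 := fun j ↦ by rw [real_inner_comm, hv]
  have hij : ∀ j, inner ℝ (J j u) (J i u) = if j = i then inner ℝ u u else (0 : ℝ) := by
    intro j
    split_ifs with h
    · rw [h, hJ.inner_map]
    · exact hJ.inner_ne h u
  simp [cross_apply, crossAux, horizontalPart_of_orthogonal J hu,
    horizontalPart_of_orthogonal J hv, hu', hv', hij]

end IsQuaternionicTriple

/-! ### Adapted frames and the standard product on ℝ⁷ -/

/-- The orthonormal `7`-frame determined by two unit vectors `n` and `x`. -/
def adaptedFrame (J : Fin 3 → W →ₗ[ℝ] W) (ε : ℝ) (n x : W) : Fin 7 → W :=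
  ![x, -ε • J 2 x, -ε • J 1 x, -ε • J 0 x, -ε • J 0 n, -ε • J 1 n, -ε • J 2 n]

/-- The standard cross product on `ℝ⁷`. -/
def crossZero (u v : Fin 7 → ℝ) : Fin 7 → ℝ :=
  ![(u 1 * v 6 - u 6 * v 1) + (u 2 * v 5 - u 5 * v 2) + (u 3 * v 4 - u 4 * v 3),
    -(u 0 * v 6 - u 6 * v 0) + (u 2 * v 4 - u 4 * v 2) - (u 3 * v 5 - u 5 * v 3),
    -(u 0 * v 5 - u 5 * v 0) - (u 1 * v 4 - u 4 * v 1) + (u 3 * v 6 - u 6 * v 3),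
    -(u 0 * v 4 - u 4 * v 0) + (u 1 * v 5 - u 5 * v 1) - (u 2 * v 6 - u 6 * v 2),
    (u 0 * v 3 - u 3 * v 0) + (u 1 * v 2 - u 2 * v 1) + (u 5 * v 6 - u 6 * v 5),
    (u 0 * v 2 - u 2 * v 0) - (u 1 * v 3 - u 3 * v 1) - (u 4 * v 6 - u 6 * v 4),
    (u 0 * v 1 - u 1 * v 0) + (u 2 * v 3 - u 3 * v 2) + (u 4 * v 5 - u 5 * v 4)]

lemma sum_fin_seven {A : Type*} [AddCommMonoid A] (F : Fin 7 → A) :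
    ∑ i, F i = F 0 + F 1 + F 2 + F 3 + F 4 + F 5 + F 6 := by
  simp [Fin.sum_univ_succ, add_assoc]

lemma coordWedge_apply (i j k : Fin 7) (u v w : Fin 7 → ℝ) :
    coordWedge i j k ![u, v, w] =
      u i * v j * w k - u i * v k * w j - u j * v i * w k + u j * v k * w i + u k * v i * w j
        - u k * v j * w i := by
  refine (Matrix.det_fin_three _).trans ?_
  simp [LinearMap.funLeft]

/-- This links the two standard models: `crossZero` is the form `omegaZero` with one index raised by
the Euclidean metric. -/
lemma omegaZero_apply (u v w : Fin 7 → ℝ) :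
    omegaZero ![u, v, w] = ∑ i, crossZero u v i * w i := by
  simp only [omegaZero, AlternatingMap.add_apply, AlternatingMap.sub_apply, coordWedge_apply]
  simp [crossZero, sum_fin_seven]
  ring

namespace IsQuaternionicTriple

variable {J : Fin 3 → W →ₗ[ℝ] W} {ε : ℝ} (hJ : IsQuaternionicTriple J ε)

include hJ

lemma orthonormal_adaptedFrame {n x : W} (hn : ‖n‖ = 1) (hx : ‖x‖ = 1)
    (hv : ∀ i, inner ℝ (J i n) x = 0) (hnx : inner ℝ n x = 0) :
    Orthonormal ℝ (adaptedFrame J ε n x) := by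
  rw [orthonormal_iff_ite]
  have h1 := hJ.inner_vertical_map hv hnx
  have h1' : ∀ i j, inner ℝ (J j x) (J i n) = 0 := fun i j ↦ by rw [real_inner_comm, h1]
  have hv' : ∀ i, inner ℝ x (J i n) = 0 := fun i ↦ by rw [real_inner_comm, hv]
  have h2 := hJ.inner_eq_ite hn
  have h3 := hJ.inner_eq_ite hx
  have h4 := fun i ↦ hJ.inner_self i x
  have h5 := fun i ↦ hJ.inner_self' i x
  intro i j
  fin_cases i <;> fin_cases j <;>
    simp [adaptedFrame, real_inner_smul_left, real_inner_smul_right, h1, h1', hv, hv', h2, h3,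
      h4, h5, norm_smul, hJ.norm_map, hJ.norm_sign, hx, hn]

/-- The factors `-ε` and the reversed order J_2, J_1, J_0 in the frame are chosen so that the
structure constants depend neither on the sign convention nor on x. For instance x times `-ε • J 2
x` is `-ε • J 2 n`, which is the term x^{127}. -/
lemma cross_sum_adaptedFrame {n x : W} (hn : ‖n‖ = 1) (hx : ‖x‖ = 1)
    (hv : ∀ i, inner ℝ (J i n) x = 0) (hnx : inner ℝ n x = 0) (u v : Fin 7 → ℝ) :
    cross J ε n (∑ i, u i • adaptedFrame J ε n x i) (∑ i, v i • adaptedFrame J ε n x i) =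
      ∑ i, crossZero u v i • adaptedFrame J ε n x i := by
  have h1 := hJ.inner_vertical_map hv hnx
  have h1' : ∀ i j, inner ℝ (J j x) (J i n) = 0 := fun i j ↦ by rw [real_inner_comm, h1]
  have hv' : ∀ i, inner ℝ x (J i n) = 0 := fun i ↦ by rw [real_inner_comm, hv]
  have h2 := hJ.inner_eq_ite hn
  have h3 := hJ.inner_eq_ite hx
  have h4 := fun i ↦ hJ.inner_self i x
  have h5 := fun i ↦ hJ.inner_self' i x
  have ha : ∀ w : Fin 7 → ℝ, ∀ i : Fin 3, inner ℝ (∑ k, w k • adaptedFrame J ε n x k) (J i n) =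
      -ε * ![w 4, w 5, w 6] i := by
    intro w i
    fin_cases i <;>
      simp [sum_fin_seven, adaptedFrame, inner_add_left, real_inner_smul_left, h1', hv', h2,
        hJ.norm_map, hn, mul_comm]
  have hp : ∀ w : Fin 7 → ℝ, horizontalPart J n (∑ k, w k • adaptedFrame J ε n x k) =
      w 0 • x - (ε * w 1) • J 2 x - (ε * w 2) • J 1 x - (ε * w 3) • J 0 x := by
    intro w
    simp only [horizontalPart, ha]
    simp [sum_fin_seven, Fin.sum_univ_three, adaptedFrame]
    module
  have hm : ∀ c : Fin 4 → ℝ,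
      J 0 (c 0 • x - (ε * c 1) • J 2 x - (ε * c 2) • J 1 x - (ε * c 3) • J 0 x) =
        c 0 • J 0 x + c 1 • J 1 x - c 2 • J 2 x + (ε * c 3) • x ∧
      J 1 (c 0 • x - (ε * c 1) • J 2 x - (ε * c 2) • J 1 x - (ε * c 3) • J 0 x) =
        c 0 • J 1 x - c 1 • J 0 x + (ε * c 2) • x + c 3 • J 2 x ∧
      J 2 (c 0 • x - (ε * c 1) • J 2 x - (ε * c 2) • J 1 x - (ε * c 3) • J 0 x) =
        c 0 • J 2 x + (ε * c 1) • x + c 2 • J 0 x - c 3 • J 1 x := by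
    intro c
    simp only [map_sub, map_smul, hJ.sq, hJ.mul, hJ.mul10, hJ.mul02, hJ.mul20, hJ.mul12, hJ.mul21]
    rcases hJ.sign with rfl | rfl <;> refine ⟨?_, ?_, ?_⟩ <;> module
  have hin : ∀ c d : Fin 4 → ℝ,
      inner ℝ (c 0 • x + c 1 • J 0 x + c 2 • J 1 x + c 3 • J 2 x)
        (d 0 • x + d 1 • J 0 x + d 2 • J 1 x + d 3 • J 2 x) =
        c 0 * d 0 + c 1 * d 1 + c 2 * d 2 + c 3 * d 3 := by
    intro c d
    simp [inner_add_left, inner_add_right, real_inner_smul_left, real_inner_smul_right, h3, h4,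
      h5, hJ.norm_map, hx]
    ring
  -- The same vector as in `hp`, reordered: the shape of `hp` fits `hm`, this one fits the scalar
  -- products in `hin`.
  have hA : ∀ w : Fin 7 → ℝ, horizontalPart J n (∑ k, w k • adaptedFrame J ε n x k) =
      w 0 • x + (-ε * w 3) • J 0 x + (-ε * w 2) • J 1 x + (-ε * w 1) • J 2 x := by
    intro w
    rw [hp]
    module
  have hm0 := fun w : Fin 7 → ℝ ↦ (hm ![w 0, w 1, w 2, w 3]).1
  have hm1 := fun w : Fin 7 → ℝ ↦ (hm ![w 0, w 1, w 2, w 3]).2.1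
  have hm2 := fun w : Fin 7 → ℝ ↦ (hm ![w 0, w 1, w 2, w 3]).2.2
  simp only [Matrix.cons_val] at hm0 hm1 hm2
  simp only [← hp] at hm0 hm1 hm2
  have hi0 : inner ℝ (J 0 (horizontalPart J n (∑ k, u k • adaptedFrame J ε n x k)))
      (horizontalPart J n (∑ k, v k • adaptedFrame J ε n x k)) =
      ε * (u 3 * v 0 - u 0 * v 3 - u 1 * v 2 + u 2 * v 1) := by
    rw [hm0, hA]
    have := hin ![ε * u 3, u 0, u 1, -u 2] ![v 0, -ε * v 3, -ε * v 2, -ε * v 1]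
    simp only [Matrix.cons_val] at this
    refine Eq.trans ?_ (this.trans (by ring))
    congr 1
    module
  have hi1 : inner ℝ (J 1 (horizontalPart J n (∑ k, u k • adaptedFrame J ε n x k)))
      (horizontalPart J n (∑ k, v k • adaptedFrame J ε n x k)) =
      ε * (u 2 * v 0 - u 0 * v 2 + u 1 * v 3 - u 3 * v 1) := by
    rw [hm1, hA]
    have := hin ![ε * u 2, -u 1, u 0, u 3] ![v 0, -ε * v 3, -ε * v 2, -ε * v 1]
    simp only [Matrix.cons_val] at this
    refine Eq.trans ?_ (this.trans (by ring))
    congr 1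
    module
  have hi2 : inner ℝ (J 2 (horizontalPart J n (∑ k, u k • adaptedFrame J ε n x k)))
      (horizontalPart J n (∑ k, v k • adaptedFrame J ε n x k)) =
      ε * (u 1 * v 0 - u 0 * v 1 - u 2 * v 3 + u 3 * v 2) := by
    rw [hm2, hA]
    have := hin ![ε * u 1, u 2, -u 3, u 0] ![v 0, -ε * v 3, -ε * v 2, -ε * v 1]
    simp only [Matrix.cons_val] at this
    refine Eq.trans ?_ (this.trans (by ring))
    congr 1
    module
  simp only [cross_apply, crossAux, Fin.sum_univ_three, hi0, hi1, hi2]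
  simp only [hm0, hm1, hm2, ha]
  simp only [adaptedFrame, sum_fin_seven, crossZero, Matrix.cons_val, Fin.isValue]
  simp only [zero_add, show (1 : Fin 3) + 1 = 2 from rfl, show (1 : Fin 3) + 2 = 0 from rfl,
    show (2 : Fin 3) + 1 = 0 from rfl, show (2 : Fin 3) + 2 = 1 from rfl, Matrix.cons_val,
    Fin.isValue]
  -- The identity needs ε² = 1, which `module` cannot use, so each sign is substituted.
  rcases hJ.sign with rfl | rfl <;> module

end IsQuaternionicTriple

end LinearAlgebra

/-! ### Transport to a 7-dimensional tangent space -/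

section Pointwise

variable {W : Type*} [NormedAddCommGroup W] [InnerProductSpace ℝ W]
  {T : Type*} [AddCommGroup T] [Module ℝ T]

/-- A unit vector `n` orthogonal to the range of `A : T → W`, such that `J i n` and `J i` of the
vectors of the range orthogonal to all `J j n` lie in the range. -/
structure IsUnitNormal (J : Fin 3 → W →ₗ[ℝ] W) (A : T →ₗ[ℝ] W) (n : W) : Prop where
  injective : Function.Injective A
  finrank_eq : finrank ℝ T = 7
  norm_eq : ‖n‖ = 1
  normal : ∀ t, inner ℝ n (A t) = 0
  vertical : ∀ i, ∃ t, A t = J i n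
  horizontal : ∀ t, (∀ i, inner ℝ (J i n) (A t) = 0) → ∀ i, ∃ t', A t' = J i (A t)

lemma IsUnitNormal.neg {J : Fin 3 → W →ₗ[ℝ] W} {A : T →ₗ[ℝ] W} {n : W}
    (h : IsUnitNormal J A n) : IsUnitNormal J A (-n) where
  injective := h.injective
  finrank_eq := h.finrank_eq
  norm_eq := by rw [norm_neg, h.norm_eq]
  normal t := by rw [inner_neg_left, h.normal, neg_zero]
  vertical i := by
    obtain ⟨t, ht⟩ := h.vertical i
    exact ⟨-t, by rw [map_neg, map_neg, ht]⟩
  horizontal t ht := h.horizontal t fun i ↦ by simpa using ht i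

/-- The bases of `T` that `A` maps to an adapted frame. -/
def IsFrameBasis (J : Fin 3 → W →ₗ[ℝ] W) (ε : ℝ) (A : T →ₗ[ℝ] W) (n : W)
    (b : Basis (Fin 7) ℝ T) : Prop :=
  ‖A (b 0)‖ = 1 ∧ (∀ i, inner ℝ (J i n) (A (b 0)) = 0) ∧
    ∀ k, A (b k) = adaptedFrame J ε n (A (b 0)) k

/-- The cross product on `T`. -/
def tangentCross (J : Fin 3 → W →ₗ[ℝ] W) (ε : ℝ) (A : T →ₗ[ℝ] W) (n : W) : T →ₗ[ℝ] T →ₗ[ℝ] T :=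
  ((cross J ε n).compl₁₂ A A).compr₂ A.leftInverse

variable {J : Fin 3 → W →ₗ[ℝ] W} {ε : ℝ} {A : T →ₗ[ℝ] W} {n : W}

/-- Three linear conditions on a 7-dimensional space have a nonzero common solution, which is then
normalized. -/
lemma IsUnitNormal.exists_horizontal (h : IsUnitNormal J A n) :
    ∃ t, ‖A t‖ = 1 ∧ ∀ i, inner ℝ (J i n) (A t) = 0 := by
  let L : T →ₗ[ℝ] (Fin 3 → ℝ) := LinearMap.pi fun i ↦ (innerₗ W (J i n)) ∘ₗ A
  have : FiniteDimensional ℝ T := .of_finrank_pos (by rw [h.finrank_eq]; norm_num)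
  have hL : LinearMap.ker L ≠ ⊥ := LinearMap.ker_ne_bot_of_finrank_lt (by simp [h.finrank_eq])
  obtain ⟨t, ht, ht0⟩ := (Submodule.ne_bot_iff _).1 hL
  have hAt : ‖A t‖ ≠ 0 := by
    rw [norm_ne_zero_iff]
    exact fun h0 ↦ ht0 (h.injective (by rw [h0, map_zero]))
  refine ⟨‖A t‖⁻¹ • t, ?_, fun i ↦ ?_⟩
  · rw [map_smul, norm_smul, norm_inv, norm_norm, inv_mul_cancel₀ hAt]
  · have := congrFun (LinearMap.mem_ker.1 ht) i
    have h' : inner ℝ (J i n) (A t) = 0 := this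
    rw [map_smul, real_inner_smul_right, h', mul_zero]

lemma IsUnitNormal.exists_isFrameBasis (hJ : IsQuaternionicTriple J ε) (h : IsUnitNormal J A n)
    {x : T} (hx : ‖A x‖ = 1) (hxv : ∀ i, inner ℝ (J i n) (A x) = 0) :
    ∃ b, IsFrameBasis J ε A n b ∧ b 0 = x := by
  choose v hv using h.vertical
  choose w hw using h.horizontal x hxv
  let e : Fin 7 → T :=
    ![x, -ε • w 2, -ε • w 1, -ε • w 0, -ε • v 0, -ε • v 1, -ε • v 2]
  have he : ∀ k, A (e k) = adaptedFrame J ε n (A x) k := by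
    intro k
    fin_cases k <;> simp [e, adaptedFrame, hv, hw]
  have hli : LinearIndependent ℝ e := by
    apply LinearIndependent.of_comp A
    have : A ∘ e = adaptedFrame J ε n (A x) := funext he
    rw [this]
    exact (hJ.orthonormal_adaptedFrame h.norm_eq hx hxv (h.normal x)).linearIndependent
  have hcard : Fintype.card (Fin 7) = finrank ℝ T := by simp [h.finrank_eq]
  have hb : ∀ k, basisOfLinearIndependentOfCardEqFinrank hli hcard k = e k := fun k ↦ by simp
  have hb0 : basisOfLinearIndependentOfCardEqFinrank hli hcard 0 = x := by rw [hb]; rfl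
  refine ⟨basisOfLinearIndependentOfCardEqFinrank hli hcard, ⟨?_, ?_, fun k ↦ ?_⟩, hb0⟩
  · rw [hb0, hx]
  · rwa [hb0]
  · rw [hb0, hb, he]

namespace IsFrameBasis

variable (hJ : IsQuaternionicTriple J ε) (h : IsUnitNormal J A n) {b : Basis (Fin 7) ℝ T}
  (hb : IsFrameBasis J ε A n b)

include hb in
lemma map_eq_sum (x : T) : A x = ∑ k, b.equivFun x k • adaptedFrame J ε n (A (b 0)) k := by
  conv_lhs => rw [← b.sum_equivFun x]
  simp only [map_sum, map_smul, ← hb.2.2]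

include hJ h hb

lemma orthonormal : Orthonormal ℝ (adaptedFrame J ε n (A (b 0))) :=
  hJ.orthonormal_adaptedFrame h.norm_eq hb.1 hb.2.1 (h.normal _)

lemma inner_eq_sum (x y : T) :
    inner ℝ (A x) (A y) = ∑ k, b.equivFun x k * b.equivFun y k := by
  rw [hb.map_eq_sum x, hb.map_eq_sum y, (hb.orthonormal hJ h).inner_sum]
  simp only [conj_trivial]

/-- The left inverse in `tangentCross` is only meaningful on the range of A. The frame expansion
shows that the ambient product of two tangent vectors lies there. -/
lemma tangentCross_eq_sum (x y : T) : tangentCross J ε A n x y =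
    ∑ k, crossZero (b.equivFun x) (b.equivFun y) k • b k := by
  change A.leftInverse (cross J ε n (A x) (A y)) = _
  rw [hb.map_eq_sum x, hb.map_eq_sum y,
    hJ.cross_sum_adaptedFrame h.norm_eq hb.1 hb.2.1 (h.normal _)]
  simp only [← hb.2.2, ← map_smul, ← map_sum]
  exact LinearMap.leftInverse_apply_of_inj (LinearMap.ker_eq_bot.2 h.injective) _

lemma equivFun_tangentCross (x y : T) : b.equivFun (tangentCross J ε A n x y) =
    crossZero (b.equivFun x) (b.equivFun y) := by
  rw [hb.tangentCross_eq_sum hJ h, ← b.equivFun_symm_apply, LinearEquiv.apply_symm_apply]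

lemma map_tangentCross (x y : T) :
    A (tangentCross J ε A n x y) = cross J ε n (A x) (A y) := by
  rw [hb.tangentCross_eq_sum hJ h, hb.map_eq_sum x, hb.map_eq_sum y,
    hJ.cross_sum_adaptedFrame h.norm_eq hb.1 hb.2.1 (h.normal _)]
  simp only [map_sum, map_smul]
  exact Finset.sum_congr rfl fun k _ ↦ congrArg _ (hb.2.2 k)

lemma omegaZero_eq (x y z : T) :
    omegaZero.compLinearMap (b.equivFun : T →ₗ[ℝ] (Fin 7 → ℝ)) ![x, y, z] =
      inner ℝ (A (tangentCross J ε A n x y)) (A z) := by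
  rw [hb.inner_eq_sum hJ h, hb.equivFun_tangentCross hJ h, ← omegaZero_apply,
    AlternatingMap.compLinearMap_apply]
  congr 1
  ext i
  fin_cases i <;> rfl

end IsFrameBasis

lemma IsUnitNormal.exists_frameBasis (hJ : IsQuaternionicTriple J ε) (h : IsUnitNormal J A n) :
    ∃ b, IsFrameBasis J ε A n b := by
  obtain ⟨x, hx, hxv⟩ := h.exists_horizontal
  obtain ⟨b, hb, -⟩ := h.exists_isFrameBasis hJ hx hxv
  exact ⟨b, hb⟩

/-! ### Cross product axioms, checked as polynomial identities in adapted coordinates -/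

section Identities

variable (hJ : IsQuaternionicTriple J ε) (h : IsUnitNormal J A n)

include hJ h

lemma IsUnitNormal.map_tangentCross (x y : T) :
    A (tangentCross J ε A n x y) = cross J ε n (A x) (A y) := by
  obtain ⟨b, hb⟩ := h.exists_frameBasis hJ
  exact hb.map_tangentCross hJ h x y

lemma IsUnitNormal.tangentCross_self (x : T) : tangentCross J ε A n x x = 0 := by
  obtain ⟨b, hb⟩ := h.exists_frameBasis hJ
  apply b.equivFun.injective
  rw [hb.equivFun_tangentCross hJ h, map_zero]
  ext k
  fin_cases k <;> simp [crossZero] <;> ring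

lemma IsUnitNormal.inner_tangentCross_left (x y : T) :
    inner ℝ (A (tangentCross J ε A n x y)) (A x) = 0 := by
  obtain ⟨b, hb⟩ := h.exists_frameBasis hJ
  rw [hb.inner_eq_sum hJ h, hb.equivFun_tangentCross hJ h]
  simp [crossZero, sum_fin_seven]
  ring

lemma IsUnitNormal.inner_tangentCross_right (x y : T) :
    inner ℝ (A (tangentCross J ε A n x y)) (A y) = 0 := by
  obtain ⟨b, hb⟩ := h.exists_frameBasis hJ
  rw [hb.inner_eq_sum hJ h, hb.equivFun_tangentCross hJ h]
  simp [crossZero, sum_fin_seven]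
  ring

lemma IsUnitNormal.inner_tangentCross_self (x y : T) :
    inner ℝ (A (tangentCross J ε A n x y)) (A (tangentCross J ε A n x y)) =
      inner ℝ (A x) (A x) * inner ℝ (A y) (A y) - inner ℝ (A x) (A y) ^ 2 := by
  obtain ⟨b, hb⟩ := h.exists_frameBasis hJ
  simp only [hb.inner_eq_sum hJ h, hb.equivFun_tangentCross hJ h]
  simp only [crossZero, sum_fin_seven, Matrix.cons_val, Fin.isValue]
  ring

lemma IsUnitNormal.tangentCross_tangentCross (x y : T) :
    tangentCross J ε A n x (tangentCross J ε A n x y) =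
      -(inner ℝ (A x) (A x) : ℝ) • y + (inner ℝ (A x) (A y) : ℝ) • x := by
  obtain ⟨b, hb⟩ := h.exists_frameBasis hJ
  apply b.equivFun.injective
  simp only [hb.inner_eq_sum hJ h, hb.equivFun_tangentCross hJ h, map_add, map_smul]
  ext k
  simp only [crossZero, sum_fin_seven, Pi.add_apply, Pi.smul_apply, smul_eq_mul]
  fin_cases k <;> simp only [Matrix.cons_val, Fin.isValue, Fin.zero_eta, Fin.mk_one,
    Fin.reduceFinMk] <;> ring

end Identities

/-- The upper block is the matrix of multiplication by a quaternion c, of determinant |c|⁴; the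
lower block is minus the identity in odd size 3. -/
lemma det_quaternion_block (c₀ c₁ c₂ c₃ : ℝ) :
    (!![c₀, -c₁, -c₂, -c₃, 0, 0, 0;
        c₁, c₀, c₃, -c₂, 0, 0, 0;
        c₂, -c₃, c₀, c₁, 0, 0, 0;
        c₃, c₂, -c₁, c₀, 0, 0, 0;
        0, 0, 0, 0, -1, 0, 0;
        0, 0, 0, 0, 0, -1, 0;
        0, 0, 0, 0, 0, 0, -1] : Matrix (Fin 7) (Fin 7) ℝ).det =
      -(c₀ ^ 2 + c₁ ^ 2 + c₂ ^ 2 + c₃ ^ 2) ^ 2 := by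
  have : (!![c₀, -c₁, -c₂, -c₃, 0, 0, 0;
        c₁, c₀, c₃, -c₂, 0, 0, 0;
        c₂, -c₃, c₀, c₁, 0, 0, 0;
        c₃, c₂, -c₁, c₀, 0, 0, 0;
        0, 0, 0, 0, -1, 0, 0;
        0, 0, 0, 0, 0, -1, 0;
        0, 0, 0, 0, 0, 0, -1] : Matrix (Fin 7) (Fin 7) ℝ) =
      Matrix.reindex finSumFinEquiv finSumFinEquiv
        (Matrix.fromBlocks (!![c₀, -c₁, -c₂, -c₃; c₁, c₀, c₃, -c₂; c₂, -c₃, c₀, c₁;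
          c₃, c₂, -c₁, c₀] : Matrix (Fin 4) (Fin 4) ℝ) 0 0
          (-1 : Matrix (Fin 3) (Fin 3) ℝ)) := by
    rw [← Equiv.symm_apply_eq]
    ext i j
    rcases i with i | i <;> rcases j with j | j <;> fin_cases i <;> fin_cases j <;> simp <;> rfl
  rw [this, Matrix.det_reindex_self, Matrix.det_fromBlocks_zero₂₁, Matrix.det_neg, Matrix.det_one]
  rw [Matrix.det_succ_row_zero]
  simp [Matrix.det_fin_three, Fin.sum_univ_succ, Matrix.submatrix, Fin.succAbove]
  ring

/-! ### Opposite normals induce opposite orientations -/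

section Orientation

variable (hJ : IsQuaternionicTriple J ε) (h : IsUnitNormal J A n) {b b' : Basis (Fin 7) ℝ T}

include hJ h

lemma IsFrameBasis.orientation_ne (hb : IsFrameBasis J ε A n b)
    (hb' : IsFrameBasis J ε A (-n) b') : b.orientation ≠ b'.orientation := by
  set c := b.equivFun (b' 0) with hc
  have hon := hb.orthonormal hJ h
  have hcoef : ∀ k, inner ℝ (adaptedFrame J ε n (A (b 0)) k) (A (b' 0)) = c k := by
    intro k
    rw [hb.map_eq_sum (b' 0), hon.inner_right_fintype]
  have hv : ∀ i, inner ℝ (J i n) (A (b' 0)) = 0 := fun i ↦ by simpa using hb'.2.1 i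
  -- Being horizontal for -n and for n is the same condition, so `b' 0` has no vertical coordinates
  -- in the basis b.
  have h4 : c 4 = 0 := by
    rw [← hcoef]
    simp [adaptedFrame, real_inner_smul_left, hv]
  have h5 : c 5 = 0 := by
    rw [← hcoef]
    simp [adaptedFrame, real_inner_smul_left, hv]
  have h6 : c 6 = 0 := by
    rw [← hcoef]
    simp [adaptedFrame, real_inner_smul_left, hv]
  have hx' : A (b' 0) = c 0 • A (b 0) + (-ε * c 1) • J 2 (A (b 0)) + (-ε * c 2) • J 1 (A (b 0))
      + (-ε * c 3) • J 0 (A (b 0)) := by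
    rw [hb.map_eq_sum (b' 0), ← hc, sum_fin_seven, h4, h5, h6]
    simp only [adaptedFrame, Matrix.cons_val, Fin.isValue]
    module
  have key : ∀ j, b' j = ∑ i, (!![c 0, -c 1, -c 2, -c 3, 0, 0, 0;
        c 1, c 0, c 3, -c 2, 0, 0, 0;
        c 2, -c 3, c 0, c 1, 0, 0, 0;
        c 3, c 2, -c 1, c 0, 0, 0, 0;
        0, 0, 0, 0, -1, 0, 0;
        0, 0, 0, 0, 0, -1, 0;
        0, 0, 0, 0, 0, 0, -1] : Matrix (Fin 7) (Fin 7) ℝ) i j • b i := by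
    intro j
    apply h.injective
    rw [hb'.2.2, hx']
    -- Naming this vector keeps the rewriting by `hby` from acting on its own right-hand side.
    obtain ⟨y, hy⟩ : ∃ y, y = A (b 0) := ⟨_, rfl⟩
    have hby := hb.2.2
    rw [← hy] at hby ⊢
    simp only [map_sum, map_smul, hby]
    rw [sum_fin_seven]
    simp only [adaptedFrame, map_add, map_smul, map_neg, hJ.sq, hJ.mul, hJ.mul10, hJ.mul02,
      hJ.mul20, hJ.mul12, hJ.mul21]
    rcases hJ.sign with rfl | rfl <;> fin_cases j <;>
      simp only [Matrix.cons_val, Matrix.of_apply, Fin.isValue, Fin.zero_eta, Fin.mk_one,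
        Fin.reduceFinMk] <;> module
  rw [Ne, b.orientation_eq_iff_det_pos, not_lt, b.det_apply]
  have hM : b.toMatrix b' = !![c 0, -c 1, -c 2, -c 3, 0, 0, 0;
        c 1, c 0, c 3, -c 2, 0, 0, 0;
        c 2, -c 3, c 0, c 1, 0, 0, 0;
        c 3, c 2, -c 1, c 0, 0, 0, 0;
        0, 0, 0, 0, -1, 0, 0;
        0, 0, 0, 0, 0, -1, 0;
        0, 0, 0, 0, 0, 0, -1] := by
    ext i j
    rw [b.toMatrix_apply, key j, b.repr_sum_self]
  rw [hM, det_quaternion_block]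
  exact neg_nonpos.2 (sq_nonneg _)

/-- There are only two orientations, and frames of n and of -n realize different ones. -/
lemma IsUnitNormal.exists_orientation_eq (o : Orientation ℝ T (Fin 7)) :
    (∃ b, IsFrameBasis J ε A n b ∧ b.orientation = o) ∨
      ∃ b, IsFrameBasis J ε A (-n) b ∧ b.orientation = o := by
  obtain ⟨b, hb⟩ := h.exists_frameBasis hJ
  obtain ⟨b', hb'⟩ := h.neg.exists_frameBasis hJ
  rcases b.orientation_eq_or_eq_neg o with ho | ho
  · exact Or.inl ⟨b, hb, ho.symm⟩
  · rcases b'.orientation_eq_or_eq_neg o with ho' | ho'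
    · exact Or.inr ⟨b', hb', ho'.symm⟩
    · exact absurd (neg_injective (ho.symm.trans ho')) (hb.orientation_ne hJ h hb')

end Orientation

end Pointwise

/-! ### Calculus of smooth vector fields along a map -/

section Smoothness

variable {E : Type*} [NormedAddCommGroup E] [NormedSpace ℝ E]
  {N : Type*} [TopologicalSpace N] [ChartedSpace E N] [IsManifold 𝓘(ℝ, E) ∞ N]
  {M : Type*} [TopologicalSpace M] [ChartedSpace (EuclideanSpace ℝ (Fin 7)) M]

/-- A vector field along `f` is smooth at `p`. -/
def SmoothAlongAt (f : M → N) (s : (p : M) → TangentSpace 𝓘(ℝ, E) (f p)) (p : M) : Prop :=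
  ContMDiffAt (𝓡 7) 𝓘(ℝ, E).tangent ∞ (fun q ↦ (⟨f q, s q⟩ : TangentBundle 𝓘(ℝ, E) N)) p

lemma SmoothAlongOn.smoothAlongAt {f : M → N} {U : Set M}
    {s : (p : M) → TangentSpace 𝓘(ℝ, E) (f p)} (hs : SmoothAlongOn f U s) (hU : IsOpen U) {p : M}
    (hp : p ∈ U) : SmoothAlongAt f s p :=
  ContMDiffOn.contMDiffAt hs (hU.mem_nhds hp)

variable {f : M → N} {p : M} {s t : (p : M) → TangentSpace 𝓘(ℝ, E) (f p)} {φ : M → ℝ}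

namespace SmoothAlongAt

lemma congr (hs : SmoothAlongAt f s p) (h : ∀ᶠ q in nhds p, t q = s q) : SmoothAlongAt f t p :=
  ContMDiffAt.congr_of_eventuallyEq hs (h.mono fun q hq ↦ by simp only [hq])

lemma base (hs : SmoothAlongAt f s p) : ContMDiffAt (𝓡 7) 𝓘(ℝ, E) ∞ f p :=
  (Bundle.contMDiffAt_totalSpace.1 hs).1

lemma eventually_mem_baseSet (hs : SmoothAlongAt f s p) : ∀ᶠ q in nhds p, f q ∈
    (trivializationAt E (TangentSpace 𝓘(ℝ, E)) (f p)).baseSet :=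
  hs.base.continuousAt.eventually_mem
    ((trivializationAt E (TangentSpace 𝓘(ℝ, E)) (f p)).open_baseSet.mem_nhds
      (FiberBundle.mem_baseSet_trivializationAt' (f p)))

lemma add (hs : SmoothAlongAt f s p) (ht : SmoothAlongAt f t p) :
    SmoothAlongAt f (fun q ↦ s q + t q) p := by
  refine Bundle.contMDiffAt_totalSpace.2 ⟨hs.base, ?_⟩
  have h := ((Bundle.contMDiffAt_totalSpace.1 hs).2).add (Bundle.contMDiffAt_totalSpace.1 ht).2
  -- The trivialization is linear on fibres over its base set only, hence the passage to a
  -- neighbourhood.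
  refine h.congr_of_eventuallyEq (hs.eventually_mem_baseSet.mono fun q hq ↦ ?_)
  exact ((trivializationAt E (TangentSpace 𝓘(ℝ, E)) (f p)).linear ℝ hq).map_add _ _

lemma smul (hφ : ContMDiffAt (𝓡 7) 𝓘(ℝ, ℝ) ∞ φ p) (hs : SmoothAlongAt f s p) :
    SmoothAlongAt f (fun q ↦ φ q • s q) p := by
  refine Bundle.contMDiffAt_totalSpace.2 ⟨hs.base, ?_⟩
  have h := hφ.smul (Bundle.contMDiffAt_totalSpace.1 hs).2
  refine h.congr_of_eventuallyEq (hs.eventually_mem_baseSet.mono fun q hq ↦ ?_)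
  exact ((trivializationAt E (TangentSpace 𝓘(ℝ, E)) (f p)).linear ℝ hq).map_smul _ _

lemma const_smul (c : ℝ) (hs : SmoothAlongAt f s p) : SmoothAlongAt f (fun q ↦ c • s q) p :=
  smul contMDiffAt_const hs

lemma neg (hs : SmoothAlongAt f s p) : SmoothAlongAt f (fun q ↦ -s q) p := by
  simpa only [neg_smul, one_smul] using hs.const_smul (-1)

lemma sub (hs : SmoothAlongAt f s p) (ht : SmoothAlongAt f t p) :
    SmoothAlongAt f (fun q ↦ s q - t q) p := by
  simpa only [sub_eq_add_neg] using hs.add ht.neg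

lemma inner [RiemannianBundle (fun x : N ↦ TangentSpace 𝓘(ℝ, E) x)]
    [IsContMDiffRiemannianBundle 𝓘(ℝ, E) ∞ E (fun x : N ↦ TangentSpace 𝓘(ℝ, E) x)]
    (hs : SmoothAlongAt f s p) (ht : SmoothAlongAt f t p) :
    ContMDiffAt (𝓡 7) 𝓘(ℝ, ℝ) ∞ (fun q ↦ (Inner.inner ℝ (s q) (t q) : ℝ)) p :=
  ContMDiffAt.inner_bundle hs ht

lemma normalize [RiemannianBundle (fun x : N ↦ TangentSpace 𝓘(ℝ, E) x)]
    [IsContMDiffRiemannianBundle 𝓘(ℝ, E) ∞ E (fun x : N ↦ TangentSpace 𝓘(ℝ, E) x)]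
    (hs : SmoothAlongAt f s p) (h0 : s p ≠ 0) : SmoothAlongAt f (fun q ↦ ‖s q‖⁻¹ • s q) p := by
  have hpos : 0 < (Inner.inner ℝ (s p) (s p) : ℝ) := real_inner_self_pos.2 h0
  simp only [norm_eq_sqrt_real_inner]
  refine smul (ContMDiffAt.inv₀ ?_ (Real.sqrt_pos.2 hpos).ne') hs
  exact (Real.contDiffAt_sqrt hpos.ne').contMDiffAt.comp p (hs.inner hs)

lemma apply {K : (x : N) → TangentSpace 𝓘(ℝ, E) x →L[ℝ] TangentSpace 𝓘(ℝ, E) x}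
    (hK : ContMDiff 𝓘(ℝ, E) (𝓘(ℝ, E).prod 𝓘(ℝ, E →L[ℝ] E)) ∞
      (fun x ↦ TotalSpace.mk' (E →L[ℝ] E)
        (E := fun x : N ↦ TangentSpace 𝓘(ℝ, E) x →L[ℝ] TangentSpace 𝓘(ℝ, E) x) x (K x)))
    (hs : SmoothAlongAt f s p) : SmoothAlongAt f (fun q ↦ K (f q) (s q)) p :=
  ContMDiffAt.clm_bundle_apply (hK.contMDiffAt.comp p hs.base) hs

end SmoothAlongAt

lemma contMDiffAt_det {ι : Type*} [Fintype ι] [DecidableEq ι] {F : M → Matrix ι ι ℝ}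
    (hF : ∀ i j, ContMDiffAt (𝓡 7) 𝓘(ℝ, ℝ) ∞ (fun q ↦ F q i j) p) :
    ContMDiffAt (𝓡 7) 𝓘(ℝ, ℝ) ∞ (fun q ↦ (F q).det) p := by
  simp only [Matrix.det_apply']
  exact contMDiffAt_finsetSum fun σ _ ↦
    contMDiffAt_const.mul (contMDiffAt_finsetProd fun i _ ↦ hF _ _)

variable [IsManifold (𝓡 7) ∞ M]

/-- A vector field on `M` is smooth at `p`. -/
def SmoothFieldAt (X : (p : M) → TangentSpace (𝓡 7) p) (p : M) : Prop :=
  ContMDiffAt (𝓡 7) (𝓡 7).tangent ∞ (fun q ↦ (⟨q, X q⟩ : TangentBundle (𝓡 7) M)) p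

lemma SmoothFieldOn.smoothFieldAt {U : Set M}
    {X : (p : M) → TangentSpace (𝓡 7) p} (hX : SmoothFieldOn U X) (hU : IsOpen U) {p : M}
    (hp : p ∈ U) : SmoothFieldAt X p :=
  ContMDiffOn.contMDiffAt hX (hU.mem_nhds hp)

lemma SmoothFieldAt.mfderiv {X : (p : M) → TangentSpace (𝓡 7) p}
    (hX : SmoothFieldAt X p) (hf : ContMDiff (𝓡 7) 𝓘(ℝ, E) ∞ f) :
    SmoothAlongAt f (fun q ↦ mfderiv (𝓡 7) 𝓘(ℝ, E) f q (X q)) p :=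
  ((hf.contMDiff_tangentMap (m := ∞) le_rfl).contMDiffAt).comp p hX

end Smoothness

/-! ### Gram matrices -/

section Gram

variable {W : Type*} [NormedAddCommGroup W] [InnerProductSpace ℝ W]
  {T : Type*} [AddCommGroup T] [Module ℝ T] {ι : Type*} [Fintype ι] [DecidableEq ι]
  {A : T →ₗ[ℝ] W}

/-- The matrix of scalar products of the images of two families. -/
def mixedGram (A : T →ₗ[ℝ] W) (b c : ι → T) : Matrix ι ι ℝ :=
  Matrix.of fun i j ↦ inner ℝ (A (b i)) (A (c j))

lemma mixedGram_self_det_pos (hA : Function.Injective A) (b : Basis ι ℝ T) :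
    0 < (mixedGram A b b).det :=
  (Matrix.posDef_gram_of_linearIndependent
    (b.linearIndependent.map' A (LinearMap.ker_eq_bot.2 hA))).det_pos

lemma mixedGram_self_mulVec (b : Basis ι ℝ T) (x : T) :
    (mixedGram A b b).mulVec (b.equivFun x) = fun i ↦ inner ℝ (A (b i)) (A x) := by
  ext i
  conv_rhs => rw [← b.sum_equivFun x]
  simp only [map_sum, map_smul, inner_sum, real_inner_smul_right]
  exact Finset.sum_congr rfl fun j _ ↦ mul_comm _ _

lemma mixedGram_eq_mul (b : Basis ι ℝ T) (c : ι → T) :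
    mixedGram A b c = mixedGram A b b * b.toMatrix c := by
  ext i j
  exact (congrFun (mixedGram_self_mulVec (A := A) b (c j)) i).symm

/-- For injective A the first factor is positive, so the relative orientation of two bases can be
read off from scalar products of their images. -/
lemma det_mixedGram (b : Basis ι ℝ T) (c : ι → T) :
    (mixedGram A b c).det = (mixedGram A b b).det * b.det c := by
  rw [mixedGram_eq_mul, Matrix.det_mul, b.det_apply]

/-- The coordinates of x solve a linear system with the Gram matrix as coefficients. Cramer's rule
makes them rational in scalar products of images, so they inherit smoothness. -/
lemma equivFun_eq_cramer (hA : Function.Injective A) (b : Basis ι ℝ T) (x : T) (j : ι) :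
    b.equivFun x j = ((mixedGram A b b).det)⁻¹ *
      ((mixedGram A b b).updateCol j fun i ↦ inner ℝ (A (b i)) (A x)).det := by
  rw [← Matrix.cramer_apply, Matrix.cramer_eq_adjugate_mulVec, ← mixedGram_self_mulVec,
    Matrix.mulVec_mulVec, Matrix.adjugate_mul, Matrix.smul_mulVec, Matrix.one_mulVec,
    Pi.smul_apply, smul_eq_mul, inv_mul_cancel_left₀ (mixedGram_self_det_pos hA b).ne']

end Gram

/-! ### Descending smoothness from fields along f to fields on M -/

section Tangential

variable {E : Type*} [NormedAddCommGroup E] [NormedSpace ℝ E] [FiniteDimensional ℝ E]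
  {N : Type*} [TopologicalSpace N] [ChartedSpace E N] [IsManifold 𝓘(ℝ, E) ∞ N]
  [RiemannianBundle (fun x : N ↦ TangentSpace 𝓘(ℝ, E) x)]
  [IsContMDiffRiemannianBundle 𝓘(ℝ, E) ∞ E (fun x : N ↦ TangentSpace 𝓘(ℝ, E) x)]
  {M : Type*} [TopologicalSpace M] [ChartedSpace (EuclideanSpace ℝ (Fin 7)) M]
  [IsManifold (𝓡 7) ∞ M]

variable (E) in
/-- The differential of `f`, as a linear map. -/
def differential (f : M → N) (p : M) :
    TangentSpace (𝓡 7) p →ₗ[ℝ] TangentSpace 𝓘(ℝ, E) (f p) :=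
  (mfderiv (𝓡 7) 𝓘(ℝ, E) f p : TangentSpace (𝓡 7) p →ₗ[ℝ] TangentSpace 𝓘(ℝ, E) (f p))

lemma SmoothFieldAt.of_differential (o : ManifoldOrientation M) {f : M → N}
    (hf : ContMDiff (𝓡 7) 𝓘(ℝ, E) ∞ f)
    (hinj : ∀ p, Function.Injective (differential E f p)) {X : (p : M) → TangentSpace (𝓡 7) p}
    {p : M} (hX : SmoothAlongAt f (fun q ↦ differential E f q (X q)) p) : SmoothFieldAt X p := by
  obtain ⟨U, hU, hp, b, hb, -⟩ := o.locally_const p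
  have hbs : ∀ i, SmoothAlongAt f (fun q ↦ differential E f q (b q i)) p :=
    fun i ↦ ((hb i).smoothFieldAt hU hp).mfderiv hf
  have hg : ∀ i j, ContMDiffAt (𝓡 7) 𝓘(ℝ, ℝ) ∞
      (fun q ↦ mixedGram (differential E f q) (b q) (b q) i j) p :=
    fun i j ↦ (hbs i).inner (hbs j)
  have hc : ∀ j, ContMDiffAt (𝓡 7) 𝓘(ℝ, ℝ) ∞ (fun q ↦ (b q).equivFun (X q) j) p := by
    intro j
    simp only [fun q ↦ equivFun_eq_cramer (hinj q) (b q) (X q) j]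
    refine (ContMDiffAt.inv₀ (contMDiffAt_det hg) (mixedGram_self_det_pos (hinj p) (b p)).ne').mul
      (contMDiffAt_det fun i k ↦ ?_)
    by_cases hk : k = j
    · subst hk
      simpa only [Matrix.updateCol_self] using (hbs i).inner hX
    · simpa only [Matrix.updateCol_ne hk] using hg i k
  have hs : ContMDiffAt (𝓡 7) (𝓡 7).tangent ∞
      (fun q ↦ (⟨q, ∑ i, (b q).equivFun (X q) i • b q i⟩ : TangentBundle (𝓡 7) M)) p :=
    ContMDiffAt.sum_section fun i _ ↦ (hc i).smul_section ((hb i).smoothFieldAt hU hp)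
  simp only [Basis.sum_equivFun] at hs
  exact hs

end Tangential

/-! ### The oriented unit normal of a QR-submanifold -/

section Hypersurface

variable {E : Type*} [NormedAddCommGroup E] [NormedSpace ℝ E] [FiniteDimensional ℝ E]
  {N : Type*} [TopologicalSpace N] [ChartedSpace E N] [IsManifold 𝓘(ℝ, E) ∞ N]
  [RiemannianBundle (fun x : N ↦ TangentSpace 𝓘(ℝ, E) x)]
  [IsContMDiffRiemannianBundle 𝓘(ℝ, E) ∞ E (fun x : N ↦ TangentSpace 𝓘(ℝ, E) x)]

/-- The complex structures of a hyper-Kähler manifold, as linear maps. -/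
def HyperKahlerStructure.linearJ (h : HyperKahlerStructure (E := E) N) (x : N) (i : Fin 3) :
    TangentSpace 𝓘(ℝ, E) x →ₗ[ℝ] TangentSpace 𝓘(ℝ, E) x :=
  (h.J i x : TangentSpace 𝓘(ℝ, E) x →ₗ[ℝ] TangentSpace 𝓘(ℝ, E) x)

lemma HyperKahlerStructure.isQuaternionicTriple (h : HyperKahlerStructure (E := E) N) (x : N) :
    IsQuaternionicTriple (h.linearJ x) h.ε where
  sign := h.ε_eq
  inner_map i v w := h.orthogonal i x v w
  sq i v := h.sq i x v
  anticomm i j v hij := h.anticomm i j x v hij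
  mul v := h.mul x v

variable {M : Type*} [TopologicalSpace M] [ChartedSpace (EuclideanSpace ℝ (Fin 7)) M]
  [IsManifold (𝓡 7) ∞ M] {h : HyperKahlerStructure (E := E) N} {f : M → N}
  {ν : (p : M) → Submodule ℝ (TangentSpace 𝓘(ℝ, E) (f p))}

namespace IsHypersurfaceTypeQR

variable (hQR : IsHypersurfaceTypeQR h f ν)

include hQR

lemma span_eq {p : M} {v : TangentSpace 𝓘(ℝ, E) (f p)} (hv : v ∈ nuPerp f ν p) (h0 : v ≠ 0) :
    nuPerp f ν p = Submodule.span ℝ {v} := by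
  refine le_antisymm (fun w hw ↦ ?_) (by simpa using hv)
  obtain ⟨c, hc⟩ := (finrank_eq_one_iff_of_nonzero' (⟨v, hv⟩ : nuPerp f ν p)
    (by simpa using h0)).1 (hQR.rank_one p) ⟨w, hw⟩
  exact Submodule.mem_span_singleton.2 ⟨c, congrArg Subtype.val hc⟩

lemma isUnitNormal {p : M} {v : TangentSpace 𝓘(ℝ, E) (f p)} (hv : v ∈ nuPerp f ν p)
    (h1 : ‖v‖ = 1) : IsUnitNormal (h.linearJ (f p)) (differential E f p) v where
  injective := hQR.immersive p
  finrank_eq := by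
    change finrank ℝ (EuclideanSpace ℝ (Fin 7)) = 7
    simp
  norm_eq := h1
  normal t := by
    rw [real_inner_comm]
    exact hv.2 _ ⟨t, rfl⟩
  vertical i := hQR.J_nuPerp i p v hv
  horizontal t ht i := by
    have hJ := h.isQuaternionicTriple (f p)
    have : FiniteDimensional ℝ (TangentSpace 𝓘(ℝ, E) (f p)) := inferInstanceAs
      (FiniteDimensional ℝ E)
    have hspan := hQR.span_eq hv (by rintro rfl; simp at h1)
    set w := h.linearJ (f p) i (differential E f p t) with hw
    have hwν : ∀ u ∈ ν p, inner ℝ u w = 0 := by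
      intro u hu
      rw [hw, ← neg_eq_zero, ← hJ.inner_left, real_inner_comm]
      exact hQR.normal p (hQR.J_nu i p u hu) _ ⟨t, rfl⟩
    have hwv : inner ℝ v w = 0 := by
      rw [hw, ← neg_eq_zero, ← hJ.inner_left]
      exact ht i
    -- The normal component z is orthogonal to ν, hence a multiple of v; since w is orthogonal to v,
    -- it vanishes.
    obtain ⟨y, hy, z, hz, hyz⟩ := (tangentImage f p).exists_add_mem_mem_orthogonal w
    have hzn : z ∈ nuPerp f ν p := by
      refine ⟨fun u hu ↦ ?_, hz⟩
      have h1 := hwν u hu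
      have h2 : inner ℝ u y = 0 := by
        rw [real_inner_comm]
        exact hQR.normal p hu y hy
      rwa [hyz, inner_add_right, h2, zero_add] at h1
    have hvy : inner ℝ v y = 0 := by
      rw [real_inner_comm]
      exact hv.2 y hy
    have hz0 : z = 0 := by
      rw [hspan] at hzn
      obtain ⟨c, rfl⟩ := Submodule.mem_span_singleton.1 hzn
      rw [hyz, inner_add_right, hvy, zero_add, real_inner_smul_right, real_inner_self_eq_norm_sq,
        h1, one_pow, mul_one] at hwv
      rw [hwv, zero_smul]
    rw [hyz, hz0, add_zero]
    exact hy

lemma exists_local_unit_section (p : M) : ∃ U : Set M, IsOpen U ∧ p ∈ U ∧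
    ∃ s : (q : M) → TangentSpace 𝓘(ℝ, E) (f q), (∀ q ∈ U, SmoothAlongAt f s q) ∧
      ∀ q ∈ U, ‖s q‖ = 1 ∧ s q ∈ nuPerp f ν q := by
  obtain ⟨U, hU, hp, k, s, hs, hsp⟩ := hQR.smooth_nuPerp p
  have hk : k = 1 := by
    have h1 := finrank_span_eq_card (hsp p hp).1
    rw [(hsp p hp).2, hQR.rank_one p, Fintype.card_fin] at h1
    exact h1.symm
  subst hk
  have hs0 : ∀ q ∈ U, s 0 q ≠ 0 := fun q hq ↦ (hsp q hq).1.ne_zero 0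
  refine ⟨U, hU, hp, fun q ↦ ‖s 0 q‖⁻¹ • s 0 q,
    fun q hq ↦ ((hs 0).smoothAlongAt hU hq).normalize (hs0 q hq),
    fun q hq ↦ ⟨norm_smul_inv_norm (𝕜 := ℝ) (hs0 q hq), Submodule.smul_mem _ _ ?_⟩⟩
  rw [← (hsp q hq).2]
  exact Submodule.subset_span ⟨0, rfl⟩

omit hQR in
lemma smoothAlongAt_horizontalPart {s u : (q : M) → TangentSpace 𝓘(ℝ, E) (f q)} {p : M}
    (hs : SmoothAlongAt f s p) (hu : SmoothAlongAt f u p) :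
    SmoothAlongAt f (fun q ↦ horizontalPart (h.linearJ (f q)) (s q) (u q)) p := by
  have hJs : ∀ i, SmoothAlongAt f (fun q ↦ h.linearJ (f q) i (s q)) p :=
    fun i ↦ hs.apply (h.smooth i)
  simp only [horizontalPart, Fin.sum_univ_three]
  exact hu.sub (((SmoothAlongAt.smul (hu.inner (hJs 0)) (hJs 0)).add
    (SmoothAlongAt.smul (hu.inner (hJs 1)) (hJs 1))).add
    (SmoothAlongAt.smul (hu.inner (hJs 2)) (hJs 2)))

omit hQR in
lemma smoothAlongAt_cross {s u v : (q : M) → TangentSpace 𝓘(ℝ, E) (f q)} {p : M}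
    (hs : SmoothAlongAt f s p) (hu : SmoothAlongAt f u p) (hv : SmoothAlongAt f v p) :
    SmoothAlongAt f (fun q ↦ cross (h.linearJ (f q)) h.ε (s q) (u q) (v q)) p := by
  have hJs : ∀ i, SmoothAlongAt f (fun q ↦ h.linearJ (f q) i (s q)) p :=
    fun i ↦ hs.apply (h.smooth i)
  have hhu : SmoothAlongAt f (fun q ↦ horizontalPart (h.linearJ (f q)) (s q) (u q)) p :=
    smoothAlongAt_horizontalPart hs hu
  have hhv : SmoothAlongAt f (fun q ↦ horizontalPart (h.linearJ (f q)) (s q) (v q)) p :=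
    smoothAlongAt_horizontalPart hs hv
  have hJu : ∀ i, SmoothAlongAt f
      (fun q ↦ h.linearJ (f q) i (horizontalPart (h.linearJ (f q)) (s q) (u q))) p :=
    fun i ↦ hhu.apply (h.smooth i)
  have hJv : ∀ i, SmoothAlongAt f
      (fun q ↦ h.linearJ (f q) i (horizontalPart (h.linearJ (f q)) (s q) (v q))) p :=
    fun i ↦ hhv.apply (h.smooth i)
  have key : ∀ i, SmoothAlongAt f (fun q ↦
      ((-h.ε * (inner ℝ (u q) (h.linearJ (f q) (i + 1) (s q))
            * inner ℝ (v q) (h.linearJ (f q) (i + 2) (s q))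
          - inner ℝ (u q) (h.linearJ (f q) (i + 2) (s q))
            * inner ℝ (v q) (h.linearJ (f q) (i + 1) (s q)))
        + inner ℝ (h.linearJ (f q) i (horizontalPart (h.linearJ (f q)) (s q) (u q)))
          (horizontalPart (h.linearJ (f q)) (s q) (v q)) : ℝ) • h.linearJ (f q) i (s q)
      + ((inner ℝ (u q) (h.linearJ (f q) i (s q)) : ℝ) •
            h.linearJ (f q) i (horizontalPart (h.linearJ (f q)) (s q) (v q))
          - (inner ℝ (v q) (h.linearJ (f q) i (s q)) : ℝ) •
            h.linearJ (f q) i (horizontalPart (h.linearJ (f q)) (s q) (u q))))) p := by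
    intro i
    refine (SmoothAlongAt.smul ((contMDiffAt_const.mul
      (((hu.inner (hJs (i + 1))).mul (hv.inner (hJs (i + 2)))).sub
        ((hu.inner (hJs (i + 2))).mul (hv.inner (hJs (i + 1)))))).add ((hJu i).inner hhv))
      (hJs i)).add ?_
    exact (SmoothAlongAt.smul (hu.inner (hJs i)) (hJv i)).sub
      (SmoothAlongAt.smul (hv.inner (hJs i)) (hJu i))
  simp only [cross_apply, crossAux, Fin.sum_univ_three]
  exact ((key 0).add (key 1)).add (key 2)

omit hQR in
lemma smoothAlongAt_adaptedFrame {s u : (q : M) → TangentSpace 𝓘(ℝ, E) (f q)} {p : M}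
    (hs : SmoothAlongAt f s p) (hu : SmoothAlongAt f u p) (k : Fin 7) :
    SmoothAlongAt f (fun q ↦ adaptedFrame (h.linearJ (f q)) h.ε (s q) (u q) k) p := by
  have hJs : ∀ i, SmoothAlongAt f (fun q ↦ -h.ε • h.linearJ (f q) i (s q)) p :=
    fun i ↦ SmoothAlongAt.const_smul _ (hs.apply (h.smooth i))
  have hJu : ∀ i, SmoothAlongAt f (fun q ↦ -h.ε • h.linearJ (f q) i (u q)) p :=
    fun i ↦ SmoothAlongAt.const_smul _ (hu.apply (h.smooth i))
  fin_cases k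
  exacts [hu, hJu 2, hJu 1, hJu 0, hJs 0, hJs 1, hJs 2]

/-- If a local unit normal section is compatible with the orientation at `p`, it is so near `p`. -/
lemma eventually_exists_frameBasis (o : ManifoldOrientation M)
    {s : (q : M) → TangentSpace 𝓘(ℝ, E) (f q)} {p : M} (hs : SmoothAlongAt f s p)
    (hsn : ∀ᶠ q in nhds p, ‖s q‖ = 1 ∧ s q ∈ nuPerp f ν q)
    (hp : ∃ b, IsFrameBasis (h.linearJ (f p)) h.ε (differential E f p) (s p) b ∧
      b.orientation = o.at_point p) :
    ∀ᶠ q in nhds p, ∃ b, IsFrameBasis (h.linearJ (f q)) h.ε (differential E f q) (s q) b ∧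
      b.orientation = o.at_point q := by
  obtain ⟨c, hc, hco⟩ := hp
  obtain ⟨U, hU, hpU, b, hb, hbo⟩ := o.locally_const p
  have hbs : ∀ i, SmoothAlongAt f (fun q ↦ differential E f q (b q i)) p :=
    fun i ↦ ((hb i).smoothFieldAt hU hpU).mfderiv hQR.smooth
  -- a horizontal field extending `c 0`
  let X : (q : M) → TangentSpace (𝓡 7) q := fun q ↦ ∑ i, (b p).equivFun (c 0) i • b q i
  have hXp : X p = c 0 := (b p).sum_equivFun (c 0)
  have hX : SmoothAlongAt f (fun q ↦ differential E f q (X q)) p := by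
    have hXs : SmoothFieldAt X p := ContMDiffAt.sum_section fun i _ ↦
      contMDiffAt_const.smul_section ((hb i).smoothFieldAt hU hpU)
    exact hXs.mfderiv hQR.smooth
  let u : (q : M) → TangentSpace 𝓘(ℝ, E) (f q) :=
    fun q ↦ horizontalPart (h.linearJ (f q)) (s q) (differential E f q (X q))
  have hu : SmoothAlongAt f u p := smoothAlongAt_horizontalPart hs hX
  have hup : u p = differential E f p (c 0) := by
    simp only [u, hXp]
    exact horizontalPart_of_orthogonal _ hc.2.1
  let w : (q : M) → TangentSpace 𝓘(ℝ, E) (f q) := fun q ↦ ‖u q‖⁻¹ • u q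
  have hup1 : ‖u p‖ = 1 := by rw [hup, hc.1]
  have hup0 : u p ≠ 0 := by
    intro h0
    rw [h0, norm_zero] at hup1
    exact zero_ne_one hup1
  have hw : SmoothAlongAt f w p := hu.normalize hup0
  have hwp : w p = differential E f p (c 0) := by
    change ‖u p‖⁻¹ • u p = _
    rw [hup1, inv_one, one_smul, hup]
  have hu0 : ∀ᶠ q in nhds p, u q ≠ 0 := by
    have := (hu.inner hu).continuousAt.eventually_ne (inner_self_ne_zero.2 hup0)
    exact this.mono fun q hq h0 ↦ hq (by rw [h0, inner_zero_left])
  -- A mixed Gram matrix written with vectors along f only: its determinant is smooth at p before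
  -- any adapted basis near p has been found, and its sign is the orientation of such a basis
  -- relative to b.
  let G : M → Matrix (Fin 7) (Fin 7) ℝ := fun q ↦ Matrix.of fun i j ↦
    inner ℝ (differential E f q (b q i)) (adaptedFrame (h.linearJ (f q)) h.ε (s q) (w q) j)
  have hG : ContMDiffAt (𝓡 7) 𝓘(ℝ, ℝ) ∞ (fun q ↦ (G q).det) p :=
    contMDiffAt_det fun i j ↦ (hbs i).inner (smoothAlongAt_adaptedFrame hs hw j)
  have hGeq : ∀ q (b' : Basis (Fin 7) ℝ (TangentSpace (𝓡 7) q)),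
      IsFrameBasis (h.linearJ (f q)) h.ε (differential E f q) (s q) b' →
      differential E f q (b' 0) = w q →
      (G q).det = (mixedGram (differential E f q) (b q) (b q)).det * (b q).det b' := by
    intro q b' hb' hb0
    rw [← det_mixedGram]
    congr 1
    ext i j
    simp only [G, mixedGram, Matrix.of_apply]
    rw [hb'.2.2 j, hb0]
  have hGp : 0 < (G p).det := by
    rw [hGeq p c hc hwp.symm]
    refine mul_pos (mixedGram_self_det_pos (hQR.immersive p) (b p)) ?_
    rw [← Basis.orientation_eq_iff_det_pos, hbo p hpU, hco]
  filter_upwards [hG.continuousAt.eventually_const_lt hGp, hu0, hsn, hU.mem_nhds hpU]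
    with q hq huq hsq hqU
  have hn := hQR.isUnitNormal hsq.2 hsq.1
  have hJ := h.isQuaternionicTriple (f q)
  have hw1 : ‖w q‖ = 1 := norm_smul_inv_norm (𝕜 := ℝ) huq
  choose v hv using hn.vertical
  have hwv : ∀ i, inner ℝ (h.linearJ (f q) i (s q)) (w q) = 0 := by
    intro i
    simp only [w, u]
    rw [real_inner_smul_right, hJ.inner_horizontalPart hsq.1, mul_zero]
  obtain ⟨x, hx⟩ : ∃ x, differential E f q x = w q := by
    -- The horizontal part of a tangent vector is tangent, because the subtracted vectors J_i n are
    -- images of the `v i`.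
    refine ⟨‖u q‖⁻¹ • (X q - ∑ i,
      (inner ℝ (differential E f q (X q)) (h.linearJ (f q) i (s q)) : ℝ) • v i), ?_⟩
    simp only [map_smul, map_sub, map_sum, hv, w, u, horizontalPart]
  obtain ⟨b', hb', hb0⟩ := hn.exists_isFrameBasis hJ (x := x) (by rw [hx, hw1])
    (by rw [hx]; exact hwv)
  refine ⟨b', hb', ?_⟩
  rw [← hbo q hqU, eq_comm, Basis.orientation_eq_iff_det_pos]
  rw [hGeq q b' hb' (by rw [hb0, hx])] at hq
  exact pos_of_mul_pos_right hq (mixedGram_self_det_pos (hQR.immersive q) (b q)).le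

/-- The unit normal field compatible with the orientation. -/
lemma exists_unit_normal (o : ManifoldOrientation M) :
    ∃ n : (p : M) → TangentSpace 𝓘(ℝ, E) (f p), (∀ p, SmoothAlongAt f n p) ∧
      (∀ p, ‖n p‖ = 1 ∧ n p ∈ nuPerp f ν p) ∧
      ∀ p, ∃ b, IsFrameBasis (h.linearJ (f p)) h.ε (differential E f p) (n p) b ∧
        b.orientation = o.at_point p := by
  have hex : ∀ p, ∃ v : TangentSpace 𝓘(ℝ, E) (f p), (‖v‖ = 1 ∧ v ∈ nuPerp f ν p) ∧
      ∃ b, IsFrameBasis (h.linearJ (f p)) h.ε (differential E f p) v b ∧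
        b.orientation = o.at_point p := by
    intro p
    obtain ⟨U, -, hp, s, -, hs⟩ := hQR.exists_local_unit_section p
    obtain ⟨h1, h2⟩ := hs p hp
    rcases (hQR.isUnitNormal h2 h1).exists_orientation_eq (h.isQuaternionicTriple (f p))
      (o.at_point p) with hb | hb
    · exact ⟨s p, ⟨h1, h2⟩, hb⟩
    · exact ⟨-s p, ⟨by rw [norm_neg, h1], Submodule.neg_mem _ h2⟩, hb⟩
  choose n hn hb using hex
  refine ⟨n, fun p ↦ ?_, hn, hb⟩
  obtain ⟨U, hU, hp, s, hs, hsn⟩ := hQR.exists_local_unit_section p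
  have hpm : ∀ q ∈ U, n q = s q ∨ n q = -s q := by
    intro q hq
    obtain ⟨h1, h2⟩ := hsn q hq
    have hmem := (hn q).2
    rw [hQR.span_eq h2 (by rintro h0; simp [h0] at h1)] at hmem
    obtain ⟨c, hc⟩ := Submodule.mem_span_singleton.1 hmem
    have hc1 : |c| = 1 := by
      have := (hn q).1
      rwa [← hc, norm_smul, h1, mul_one, Real.norm_eq_abs] at this
    rcases (abs_eq zero_le_one).1 hc1 with rfl | rfl
    · exact Or.inl (by rw [← hc, one_smul])
    · exact Or.inr (by rw [← hc, neg_smul, one_smul])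
  -- The pointwise choice n is ± a smooth section. If the signs agree at p, they agree nearby: t
  -- stays compatible with the orientation, and n = -t at such a point would contradict
  -- `orientation_ne`.
  have key : ∀ t : (q : M) → TangentSpace 𝓘(ℝ, E) (f q), SmoothAlongAt f t p →
      (∀ q ∈ U, ‖t q‖ = 1 ∧ t q ∈ nuPerp f ν q) → (∀ q ∈ U, n q = t q ∨ n q = -t q) →
      n p = t p → SmoothAlongAt f n p := by
    intro t ht htn htpm hpt
    refine ht.congr ?_
    have hev := hQR.eventually_exists_frameBasis o ht
      (Filter.eventually_of_mem (hU.mem_nhds hp) htn) (hpt ▸ hb p)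
    filter_upwards [hev, hU.mem_nhds hp] with q ⟨b, hbq, hbo⟩ hqU
    refine (htpm q hqU).resolve_right fun hneg ↦ ?_
    obtain ⟨b', hb', hbo'⟩ := hb q
    rw [hneg] at hb'
    exact hbq.orientation_ne (h.isQuaternionicTriple (f q))
      (hQR.isUnitNormal (htn q hqU).2 (htn q hqU).1) hb' (hbo.trans hbo'.symm)
  rcases hpm p hp with hnp | hnp
  · exact key s (hs p hp) hsn hpm hnp
  · refine key (fun q ↦ -s q) (hs p hp).neg (fun q hq ↦ ⟨?_, ?_⟩) (fun q hq ↦ ?_) hnp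
    · rw [norm_neg, (hsn q hq).1]
    · exact Submodule.neg_mem _ (hsn q hq).2
    · rw [neg_neg]
      exact (hpm q hq).symm

end IsHypersurfaceTypeQR

end Hypersurface

end QRG2

end

theorem theorem1 {E : Type*} [NormedAddCommGroup E] [NormedSpace ℝ E] [FiniteDimensional ℝ E]
    {N : Type*} [TopologicalSpace N] [ChartedSpace E N] [IsManifold 𝓘(ℝ, E) ∞ N]
    [RiemannianBundle (fun x : N ↦ TangentSpace 𝓘(ℝ, E) x)]
    [IsContMDiffRiemannianBundle 𝓘(ℝ, E) ∞ E (fun x : N ↦ TangentSpace 𝓘(ℝ, E) x)]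
    (h : QRG2.HyperKahlerStructure (E := E) N)
    {M : Type*} [TopologicalSpace M] [ChartedSpace (EuclideanSpace ℝ (Fin 7)) M]
    [IsManifold (𝓡 7) ∞ M] (o : QRG2.ManifoldOrientation M)
    (f : M → N) (ν : (p : M) → Submodule ℝ (TangentSpace 𝓘(ℝ, E) (f p)))
    (hQR : QRG2.IsHypersurfaceTypeQR h f ν) :
    ∃ (n : (p : M) → TangentSpace 𝓘(ℝ, E) (f p))
      (ξ : Fin 3 → (p : M) → TangentSpace (𝓡 7) p)
      (P : (p : M) → TangentSpace (𝓡 7) p →ₗ[ℝ] TangentSpace (𝓡 7) p →ₗ[ℝ] TangentSpace (𝓡 7) p)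
      (Ω : QRG2.G2Structure o),
      -- `n` is a smooth global unit section that spans the line bundle `ν^⊥`
      QRG2.SmoothAlongOn f Set.univ n ∧
      (∀ p, ‖n p‖ = 1 ∧ QRG2.nuPerp f ν p = Submodule.span ℝ {n p}) ∧
      -- `ξ i = J i n`, as smooth vector fields on `M`
      (∀ i, QRG2.SmoothFieldOn Set.univ (ξ i)) ∧
      (∀ i p, mfderiv (𝓡 7) 𝓘(ℝ, E) f p (ξ i p) = h.J i (f p) (n p)) ∧
      -- `P` is a cross product compatible with the induced metric
      QRG2.IsCrossProduct (QRG2.inducedMetric E f) P ∧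
      -- the formulas for `P`: on the `ξ i`, and on vectors `x` orthogonal to all the `ξ i`
      (∀ i p, P p (ξ i p) (ξ (i + 1) p) = -h.ε • ξ (i + 2) p) ∧
      (∀ i p x, (∀ j, QRG2.inducedMetric E f p (ξ j p) x = 0) →
        mfderiv (𝓡 7) 𝓘(ℝ, E) f p (P p (ξ i p) x) =
          h.J i (f p) (mfderiv (𝓡 7) 𝓘(ℝ, E) f p x)) ∧
      (∀ i p x y, (∀ j, QRG2.inducedMetric E f p (ξ j p) x = 0) →
        mfderiv (𝓡 7) 𝓘(ℝ, E) f p y = h.J i (f p) (mfderiv (𝓡 7) 𝓘(ℝ, E) f p x) →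
        P p x y = QRG2.inducedMetric E f p x x • ξ i p) ∧
      -- `Ω` is the `3`-form of `P` and the induced metric, and its metric is the induced one
      (∀ p x y z, Ω.form p ![x, y, z] = QRG2.inducedMetric E f p (P p x y) z) ∧
      (∀ p, ∃ b : Module.Basis (Fin 7) ℝ (TangentSpace (𝓡 7) p),
        b.orientation = o.at_point p ∧ QRG2.IsAdapted (Ω.form p) b ∧
        ∀ i j, QRG2.inducedMetric E f p (b i) (b j) = if i = j then 1 else 0) := by
  obtain ⟨n, hns, hn, hb⟩ := hQR.exists_unit_normal o
  choose b hb hbo using hb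
  have hJ := fun p ↦ h.isQuaternionicTriple (f p)
  have hN : ∀ p, QRG2.IsUnitNormal (h.linearJ (f p)) (QRG2.differential E f p) (n p) :=
    fun p ↦ hQR.isUnitNormal (hn p).2 (hn p).1
  choose ξ hξ using fun p ↦ (hN p).vertical
  let P : (p : M) → TangentSpace (𝓡 7) p →ₗ[ℝ] TangentSpace (𝓡 7) p →ₗ[ℝ] TangentSpace (𝓡 7) p :=
    fun p ↦ QRG2.tangentCross (h.linearJ (f p)) h.ε (QRG2.differential E f p) (n p)
  have hP : ∀ p x y, QRG2.differential E f p (P p x y) = QRG2.cross (h.linearJ (f p)) h.ε (n p)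
      (QRG2.differential E f p x) (QRG2.differential E f p y) :=
    fun p x y ↦ (hN p).map_tangentCross (hJ p) x y
  have hinj : ∀ p, Function.Injective (QRG2.differential E f p) := hQR.immersive
  have hPs : ∀ (X Y : (p : M) → TangentSpace (𝓡 7) p) (p : M), QRG2.SmoothFieldAt X p →
      QRG2.SmoothFieldAt Y p →
      QRG2.SmoothAlongAt f (fun q ↦ QRG2.differential E f q (P q (X q) (Y q))) p := by
    intro X Y p hX hY
    simp only [hP]
    exact QRG2.IsHypersurfaceTypeQR.smoothAlongAt_cross (hns p) (hX.mfderiv hQR.smooth)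
      (hY.mfderiv hQR.smooth)
  have hΩ : ∀ p x y z, (QRG2.omegaZero.compLinearMap
      ((b p).equivFun : TangentSpace (𝓡 7) p →ₗ[ℝ] (Fin 7 → ℝ))) ![x, y, z] =
      QRG2.inducedMetric E f p (P p x y) z :=
    fun p x y z ↦ (hb p).omegaZero_eq (hJ p) (hN p) x y z
  -- The bases `b p` are chosen pointwise, with no continuity. Smoothness of the form comes from
  -- `hΩ`, which expresses it through P and the metric.
  let Ω : QRG2.G2Structure o :=
    { form := fun p ↦ QRG2.omegaZero.compLinearMap
        ((b p).equivFun : TangentSpace (𝓡 7) p →ₗ[ℝ] (Fin 7 → ℝ))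
      smooth := by
        intro U X hU hX p hp
        have hX' := fun i ↦ (hX i).smoothFieldAt hU hp
        have key : ∀ q, (QRG2.omegaZero.compLinearMap
            ((b q).equivFun : TangentSpace (𝓡 7) q →ₗ[ℝ] (Fin 7 → ℝ))) (fun i ↦ X i q) =
            inner ℝ (QRG2.differential E f q (P q (X 0 q) (X 1 q)))
              (QRG2.differential E f q (X 2 q)) := by
          intro q
          have hvec : (fun i ↦ X i q) = ![X 0 q, X 1 q, X 2 q] := by
            ext1 i
            fin_cases i <;> rfl
          rw [hvec]
          exact hΩ q _ _ _
        simp only [key]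
        exact ((hPs _ _ p (hX' 0) (hX' 1)).inner
          ((hX' 2).mfderiv hQR.smooth)).contMDiffWithinAt
      standard := fun p ↦ ⟨b p, hbo p, rfl⟩ }
  have hhor : ∀ p x, (∀ j, QRG2.inducedMetric E f p (ξ p j) x = 0) →
      ∀ i, inner ℝ (h.linearJ (f p) i (n p)) (QRG2.differential E f p x) = 0 := by
    intro p x hx i
    rw [← hξ p i]
    exact hx i
  refine ⟨n, fun i p ↦ ξ p i, P, Ω, fun p _ ↦ (hns p).contMDiffWithinAt,
    fun p ↦ ⟨(hn p).1, hQR.span_eq (hn p).2 ?_⟩, fun i p _ ↦ ?_, fun i p ↦ hξ p i, ?_, fun i p ↦ ?_,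
    fun i p x hx ↦ ?_, fun i p x y hx hy ↦ ?_, hΩ, fun p ↦ ⟨b p, hbo p, rfl, fun i j ↦ ?_⟩⟩
  · intro h0
    have h1 := (hn p).1
    rw [h0, norm_zero] at h1
    exact zero_ne_one h1
  · refine ContMDiffAt.contMDiffWithinAt
      (QRG2.SmoothFieldAt.of_differential o hQR.smooth hinj (X := fun q ↦ ξ q i) ?_)
    simp only [hξ]
    exact (hns p).apply (h.smooth i)
  · exact
      { smooth := fun U X Y hU hX hY p hp ↦ ContMDiffAt.contMDiffWithinAt
          (QRG2.SmoothFieldAt.of_differential o hQR.smooth hinj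
            (hPs X Y p (hX.smoothFieldAt hU hp) (hY.smoothFieldAt hU hp)))
        alternating := fun p ↦ (hN p).tangentCross_self (hJ p)
        orthogonal_left := fun p ↦ (hN p).inner_tangentCross_left (hJ p)
        orthogonal_right := fun p ↦ (hN p).inner_tangentCross_right (hJ p)
        norm_sq := fun p ↦ (hN p).inner_tangentCross_self (hJ p)
        double := fun p ↦ (hN p).tangentCross_tangentCross (hJ p) }
  -- The formula for P is an equality in the tangent space of M; it is checked in the ambient space,
  -- the differential being injective.
  · apply hinj p
    refine (hP p _ _).trans ?_
    rw [hξ, hξ, (hJ p).cross_vertical (hn p).1, ← hξ]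
    exact (map_smul (QRG2.differential E f p) _ _).symm
  · refine (hP p _ _).trans ?_
    rw [hξ]
    exact (hJ p).cross_vertical_horizontal (hn p).1 (hhor p x hx) i
  · apply hinj p
    have hy' : QRG2.differential E f p y = h.linearJ (f p) i (QRG2.differential E f p x) := hy
    refine (hP p _ _).trans ?_
    rw [hy', (hJ p).cross_horizontal_map (hhor p x hx) ((hN p).normal x), ← hξ]
    exact (map_smul (QRG2.differential E f p) _ _).symm
  · have hon := orthonormal_iff_ite.1 ((hb p).orthonormal (hJ p) (hN p)) i j
    rw [← (hb p).2.2, ← (hb p).2.2] at hon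
    exact hon
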